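/- Let $m$ be normalized arc length on the unit circle $\mathbb T$, let $L^\infty=L^\infty(\mathbb T,m)$ (complex-valued), and let $H^\infty$ be the set of $f\in L^\infty$ whose Fourier coefficients of negative index vanish. A norm $\alpha$ on $L^\infty$ is a $\|\cdot\|_1$-dominating normalized gauge norm if $\alpha(1)=1$, and $\alpha(|f|)=\alpha(f)$ and $\alpha(f)\ge\|f\|_1$ for all $f\in L^\infty$; it is continuous if $\alpha(\chi_E)\to 0$ as $m(E)\to 0^+$. For measurable $f:\mathbb T\to\mathbb C$ put $\alpha(f)=\sup\{\alpha(s): s \text{ simple},\ 0\le s\le |f|\}\in[0,\infty]$. Identifying functions that are equal a.e., let $\mathcal L^\alpha=\{f:\alpha(f)<\infty\}$, and let $L^\alpha$ and $H^\alpha$ be the $\alpha$-closures of $L^\infty$ and of $H^\infty$ in $\mathcal L^\alpha$. A measurable function $\varphi$ is unimodular if $|\varphi|=1$ a.e., and inner if moreover $\varphi\in H^\infty$. **Theorem 3.6.** Let $\alpha$ be a continuous $\|\cdot\|_1$-dominating normalized gauge norm and let $W$ be an $\alpha$-closed linear subspace of $L^\alpha$. Then $zW\subseteq W$ if and only if $W=\varphi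 H^\alpha$ for some unimodular function $\varphi$ or $W=\chi_E L^\alpha$ for some Borel set $E\subseteq\mathbb T$. If moreover $zW\subseteq W$ and $0\ne W\subseteq H^\alpha$, then $W=\varphi H^\alpha$ for some inner function $\varphi$. -/

import Mathlib

open MeasureTheory

open scoped ENNReal NNReal

noncomputable section

namespace GaugeHardy

instance fact_two_pi_pos : Fact (0 < 2 * Real.pi) := ⟨Real.two_pi_pos⟩

/-- The unit circle, written as `ℝ / 2πℤ`; the point `θ` stands for `exp (i θ)`. -/
abbrev Torus : Type := AddCircle (2 * Real.pi)

/-- Normalized arc length (Haar probability measure) on the circle. -/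
abbrev haar : Measure Torus := AddCircle.haarAddCircle

/-- Measurable complex functions on the circle, modulo equality almost everywhere. -/
abbrev LZero : Type := Torus →ₘ[haar] ℂ

/-- `L^∞` of the circle. -/
abbrev LInf : Type := Lp ℂ ∞ haar

/-- The coordinate function `z`, that is `θ ↦ exp (i θ)`. -/
def zfun : LZero := AEEqFun.mk (fun t : Torus => (AddCircle.toCircle t : ℂ))
  (Continuous.aestronglyMeasurable (by fun_prop))

/-- The characteristic function of a measurable set, as an element of `L^∞`. -/
def chi (E : Set Torus) (hE : MeasurableSet E) : LInf :=
  indicatorConstLp ∞ hE (measure_ne_top haar E) (1 : ℂ)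

/-- `α` is a norm on the complex vector space `L^∞` with `α 1 = 1`, `α |f| = α f` and
`‖f‖₁ ≤ α f`. -/
structure IsDominatingGaugeNorm (α : LInf → ℝ) : Prop where
  eq_zero_iff : ∀ f, α f = 0 ↔ f = 0
  add_le : ∀ f g, α (f + g) ≤ α f + α g
  smul_eq : ∀ (c : ℂ) f, α (c • f) = ‖c‖ * α f
  one_eq : α (chi Set.univ MeasurableSet.univ) = 1
  abs_eq : ∀ f g : LInf, (∀ᵐ t ∂haar, g t = ((‖f t‖ : ℝ) : ℂ)) → α g = α f
  norm_one_le : ∀ f : LInf, ∫ t, ‖f t‖ ∂haar ≤ α f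

/-- Continuity of a gauge norm: `α (χ_E) → 0` as the measure of `E` tends to `0`. -/
def IsContinuousGauge (α : LInf → ℝ) : Prop :=
  ∀ ε : ℝ, 0 < ε → ∃ δ : ℝ, 0 < δ ∧
    ∀ (E : Set Torus) (hE : MeasurableSet E), haar.real E < δ → α (chi E hE) < ε

/-- A nonnegative simple function, as an element of `L^∞`. -/
def simpleToLInf (s : SimpleFunc Torus ℝ≥0) : LInf :=
  MemLp.toLp _ ((s.map (fun x : ℝ≥0 => ((x : ℝ) : ℂ))).memLp_top haar)

/-- The extension of `α` to all measurable functions, with values in `[0, ∞]`: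
`α f = sup {α s : s simple, 0 ≤ s ≤ |f|}`. -/
def gaugeExt (α : LInf → ℝ) (f : LZero) : ℝ≥0∞ :=
  ⨆ (s : SimpleFunc Torus ℝ≥0) (_ : ∀ᵐ t ∂haar, s t ≤ ‖f t‖₊), ENNReal.ofReal (α (simpleToLInf s))

/-- The closure of `S`, for the norm `α`, in the space of all `f` with `α f < ∞`. -/
def gaugeClosure (α : LInf → ℝ) (S : Set LZero) : Set LZero :=
  {f | gaugeExt α f < ∞ ∧ ∀ ε : ℝ≥0∞, 0 < ε → ∃ g ∈ S, gaugeExt α (f - g) < ε}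

/-- `L^∞` as a set of (classes of) measurable functions. -/
def LInfSet : Set LZero := {f | f ∈ Lp ℂ ∞ haar}

/-- `H^∞`: the functions in `L^∞` whose Fourier coefficients of negative index vanish. -/
def HInfSet : Set LZero := {f | f ∈ LInfSet ∧ ∀ n : ℤ, n < 0 → fourierCoeff f n = 0}

/-- `L^α`, the `α`-closure of `L^∞`. -/
def LGauge (α : LInf → ℝ) : Set LZero := gaugeClosure α LInfSet

/-- `H^α`, the `α`-closure of `H^∞`. -/
def HGauge (α : LInf → ℝ) : Set LZero := gaugeClosure α HInfSet

/-- `W` is a linear subspace of `L^α` that is closed in `L^α` for the norm `α`. -/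
structure IsClosedSubspace (α : LInf → ℝ) (W : Submodule ℂ LZero) : Prop where
  subset_LGauge : (W : Set LZero) ⊆ LGauge α
  closed : ∀ f ∈ LGauge α, f ∈ gaugeClosure α (W : Set LZero) → f ∈ W

/-- `|φ| = 1` almost everywhere. -/
def IsUnimodular (φ : LZero) : Prop := ∀ᵐ t ∂haar, ‖φ t‖ = 1

/-- Inner functions: unimodular functions in `H^∞`. -/
def IsInner (φ : LZero) : Prop := φ ∈ HInfSet ∧ IsUnimodular φ

/-- The set `φ S` of all products `φ f` with `f` in `S`. -/
def mulSet (φ : LZero) (S : Set LZero) : Set LZero := (fun f : LZero => φ * f) '' S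

end GaugeHardy

end

noncomputable section

open Filter Topology

open scoped ComplexConjugate InnerProductSpace

namespace GaugeHardy

/-! The invariant subspaces are classified in `L²`, where orthogonality is available, and the result
is carried over to `L^α`. Let `K` be the `L²`-closure of the bounded elements of `W`. Two facts link
them: every element of `W` is an `α`-limit of bounded elements of `W` (`mem_gaugeClosure_bounded`),
and every bounded element of `K` lies in `W` (`mem_of_mem_closure_boundedPart`).

Both rest on damping. For integrable `g` there is `h` in `H^∞` with `|h|² = 1 / (1 + |g|)` and `‖h -
1‖₂² ≤ ‖g‖₁` (`exists_HInf_damping`). Multiplication by `h²` makes `g` bounded, keeps `W` invariant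
because `H^∞ W ⊆ W` (`HInf_mul_mem`, by Fejér means), and hardly changes anything when `g` is small
in `L¹`. The resulting sequences converge almost everywhere under a bound by an element of `L^α`;
continuity of `α` gives a dominated convergence theorem (`tendsto_gaugeExt_zero`), and closedness of
`W` does the rest.

In `L²` there are two cases. If `K` is also invariant under `z⁻¹`, the projection of `1` onto `K` is
a characteristic function `χ_E`, and `W = χ_E L^α`. Otherwise a unit vector `φ` of `K` orthogonal to
`zK` is orthogonal to all its own forward shifts, so `|φ|²` has only its zeroth Fourier coefficient
and `φ` is unimodular; orthogonality to `zK` says that `conj φ` maps bounded elements of `W` into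
`H^∞`, and `W = φ H^α`.

Inside `H^α` the first case forces every Fourier coefficient of `χ_E` to vanish, and in the second
`φ = φ · 1` is itself in `H^α`, hence inner. -/

/-- The class in `L^∞` of a bounded measurable function. -/
def ofBdd (F : Torus → ℂ) (hF : AEStronglyMeasurable F haar) (C : ℝ)
    (hC : ∀ᵐ t ∂haar, ‖F t‖ ≤ C) : LInf :=
  MemLp.toLp F (memLp_top_of_bound hF C hC)

theorem coeFn_ofBdd (F : Torus → ℂ) (hF : AEStronglyMeasurable F haar) (C : ℝ)
    (hC : ∀ᵐ t ∂haar, ‖F t‖ ≤ C) : (ofBdd F hF C hC : Torus → ℂ) =ᵐ[haar] F :=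
  MemLp.coeFn_toLp _

theorem mem_LInfSet_of_bound {f : LZero} (C : ℝ) (hC : ∀ᵐ t ∂haar, ‖f t‖ ≤ C) : f ∈ LInfSet :=
  Lp.mem_Lp_iff_memLp.2 (memLp_top_of_bound f.aestronglyMeasurable C hC)

theorem exists_bound_of_mem_LInfSet {f : LZero} (hf : f ∈ LInfSet) :
    ∃ C : ℝ, 0 < C ∧ ∀ᵐ t ∂haar, ‖f t‖ ≤ C := by
  have h : MemLp f ∞ haar := Lp.mem_Lp_iff_memLp.1 hf
  refine ⟨(eLpNorm f ∞ haar).toReal + 1, by positivity, ?_⟩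
  have h1 : ∀ᵐ t ∂haar, ‖f t‖ₑ ≤ eLpNormEssSup f haar := ae_le_eLpNormEssSup
  filter_upwards [h1] with t ht
  have h2 : eLpNorm f ∞ haar ≠ ∞ := h.2.ne
  rw [← eLpNorm_exponent_top] at ht
  have := ENNReal.toReal_mono h2 ht
  simp only [toReal_enorm] at this
  linarith

/-! ### Monotonicity of a gauge norm on `L^∞` -/

namespace IsDominatingGaugeNorm

variable {α : LInf → ℝ} (hα : IsDominatingGaugeNorm α)
include hα

theorem congr_norm {f g : LInf} (h : ∀ᵐ t ∂haar, ‖f t‖ = ‖g t‖) : α f = α g := by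
  obtain ⟨C, -, hC⟩ := exists_bound_of_mem_LInfSet f.2
  have hm : AEStronglyMeasurable (fun t => ((‖f t‖ : ℝ) : ℂ)) haar :=
    Complex.continuous_ofReal.comp_aestronglyMeasurable (Lp.aestronglyMeasurable f).norm
  set F := ofBdd (fun t => ((‖f t‖ : ℝ) : ℂ)) hm C (by simpa using hC) with hF
  have h1 : α F = α f := hα.abs_eq f F (coeFn_ofBdd _ _ _ _)
  have h2 : α F = α g := hα.abs_eq g F (by
    filter_upwards [coeFn_ofBdd _ hm C (by simpa using hC), h] with t h1 h2
    rw [hF, h1, h2])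
  rw [← h1, h2]

theorem mono {f g : LInf} (h : ∀ᵐ t ∂haar, ‖f t‖ ≤ ‖g t‖) : α f ≤ α g := by
  obtain ⟨C, -, hC⟩ := exists_bound_of_mem_LInfSet g.2
  -- The function `w` has modulus `|g|` and real part `|f|`, so `|f|` is the average of `w` and its
  -- conjugate, two functions with the same `α`-value as `g`.
  let w : Torus → ℂ := fun t => ⟨‖f t‖, Real.sqrt (‖g t‖ ^ 2 - ‖f t‖ ^ 2)⟩
  have hw : Measurable w := by
    have hf : Measurable (f : Torus → ℂ) := (Lp.stronglyMeasurable f).measurable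
    have hg : Measurable (g : Torus → ℂ) := (Lp.stronglyMeasurable g).measurable
    have : w = fun t => ((‖f t‖ : ℝ) : ℂ) +
        ((Real.sqrt (‖g t‖ ^ 2 - ‖f t‖ ^ 2) : ℝ) : ℂ) * Complex.I := by
      funext t
      apply Complex.ext <;> simp [w]
    rw [this]
    fun_prop
  have hn : ∀ᵐ t ∂haar, ‖w t‖ = ‖g t‖ := by
    filter_upwards [h] with t ht
    have h0 : 0 ≤ ‖g t‖ ^ 2 - ‖f t‖ ^ 2 := by
      have := norm_nonneg (f t)
      nlinarith
    rw [Complex.norm_def, Complex.normSq_apply]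
    simp only [w]
    rw [Real.mul_self_sqrt h0]
    rw [show ‖f t‖ * ‖f t‖ + (‖g t‖ ^ 2 - ‖f t‖ ^ 2) = ‖g t‖ ^ 2 by ring]
    exact Real.sqrt_sq (norm_nonneg _)
  have hb : ∀ᵐ t ∂haar, ‖w t‖ ≤ C := by
    filter_upwards [hn, hC] with t h1 h2
    rwa [h1]
  have hb' : ∀ᵐ t ∂haar, ‖star (w t)‖ ≤ C := by simpa using hb
  let W := ofBdd w hw.aestronglyMeasurable C hb
  have hws : Measurable fun t => star (w t) := by
    have := Complex.continuous_conj.measurable.comp hw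
    exact this
  let V := ofBdd (fun t => star (w t)) hws.aestronglyMeasurable C hb'
  have eW : (W : Torus → ℂ) =ᵐ[haar] w := coeFn_ofBdd _ _ _ _
  have eV : (V : Torus → ℂ) =ᵐ[haar] fun t => star (w t) := coeFn_ofBdd _ _ _ _
  have hW : α W = α g := hα.congr_norm (by
    filter_upwards [eW, hn] with t h1 h2
    rw [h1, h2])
  have hV : α V = α g := hα.congr_norm (by
    filter_upwards [eV, hn] with t h1 h2
    rw [h1, norm_star, h2])
  have hf : α f = α ((1 / 2 : ℂ) • (W + V)) := hα.congr_norm (by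
    filter_upwards [eW, eV, Lp.coeFn_smul (1 / 2 : ℂ) (W + V), Lp.coeFn_add W V] with t h1 h2 h3 h4
    rw [h3, Pi.smul_apply, h4, Pi.add_apply, h1, h2]
    have : (1 / 2 : ℂ) • (w t + star (w t)) = ((‖f t‖ : ℝ) : ℂ) := by
      apply Complex.ext <;> simp [w]
      ring
    rw [this]
    simp)
  rw [hf, hα.smul_eq]
  have := hα.add_le W V
  norm_num
  linarith

theorem nonneg (f : LInf) : 0 ≤ α f :=
  (integral_nonneg fun _ => norm_nonneg _).trans (hα.norm_one_le f)

theorem le_of_bound {f : LInf} {C : ℝ} (hC : 0 ≤ C) (h : ∀ᵐ t ∂haar, ‖f t‖ ≤ C) : α f ≤ C := by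
  have h1 : α f ≤ α ((C : ℂ) • chi Set.univ MeasurableSet.univ) := hα.mono (by
    filter_upwards [h, Lp.coeFn_smul (C : ℂ) (chi Set.univ MeasurableSet.univ),
      (indicatorConstLp_coeFn (p := ∞) (hs := MeasurableSet.univ)
        (hμs := measure_ne_top haar Set.univ) (c := (1 : ℂ)))] with t h1 h2 h3
    rw [h2, Pi.smul_apply, chi, h3]
    simpa [abs_of_nonneg hC] using h1)
  rw [hα.smul_eq, hα.one_eq] at h1
  simpa [abs_of_nonneg hC] using h1

end IsDominatingGaugeNorm

/-! ### The extension of the gauge norm to measurable functions -/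

theorem coeFn_simpleToLInf (s : SimpleFunc Torus ℝ≥0) :
    (simpleToLInf s : Torus → ℂ) =ᵐ[haar] fun t => ((s t : ℝ) : ℂ) :=
  MemLp.coeFn_toLp _

theorem gaugeExt_mono {α : LInf → ℝ} {f g : LZero} (h : ∀ᵐ t ∂haar, ‖f t‖ ≤ ‖g t‖) :
    gaugeExt α f ≤ gaugeExt α g := by
  refine iSup₂_le fun s hs => le_iSup₂_of_le s ?_ le_rfl
  filter_upwards [h, hs] with t h1 h2
  exact h2.trans h1

/-- Rounding `|f|` down to a multiple of `ε` is within `ε` of `|f|`; boundedness leaves finitely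
many values. -/
theorem exists_simpleFunc_approx {f : LZero} (hf : f ∈ LInfSet) {ε : ℝ} (hε : 0 < ε) :
    ∃ s : SimpleFunc Torus ℝ≥0, (∀ᵐ t ∂haar, s t ≤ ‖f t‖₊) ∧
      ∀ᵐ t ∂haar, ‖f t‖ ≤ s t + ε := by
  obtain ⟨C, -, hC⟩ := exists_bound_of_mem_LInfSet hf
  -- The minimum with `⌊C / ε⌋₊` makes the range finite at every point, since the bound on `f` holds
  -- only almost everywhere.
  have hm : Measurable fun t => min ⌊‖f t‖ / ε⌋₊ ⌊C / ε⌋₊ := by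
    have : Measurable f := f.measurable
    exact (Nat.measurable_floor.comp (this.norm.div_const ε)).min measurable_const
  let k : SimpleFunc Torus ℕ :=
    ⟨fun t => min ⌊‖f t‖ / ε⌋₊ ⌊C / ε⌋₊, fun n => hm (MeasurableSet.singleton n),
      (Set.finite_Iic ⌊C / ε⌋₊).subset (by rintro _ ⟨t, rfl⟩; exact min_le_right (⌊‖f t‖ / ε⌋₊) _)⟩
  have hk : ∀ᵐ t ∂haar, k t = ⌊‖f t‖ / ε⌋₊ := by
    filter_upwards [hC] with t ht
    exact min_eq_left (Nat.floor_mono (div_le_div_of_nonneg_right ht hε.le))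
  refine ⟨k.map fun n : ℕ => (n : ℝ≥0) * ε.toNNReal, ?_, ?_⟩
  · filter_upwards [hk] with t ht
    rw [SimpleFunc.map_apply, ht, ← NNReal.coe_le_coe]
    have := Nat.floor_le (show 0 ≤ ‖f t‖ / ε by positivity)
    rw [le_div_iff₀ hε] at this
    rw [NNReal.coe_mul, NNReal.coe_natCast, Real.coe_toNNReal _ hε.le]
    exact this
  · filter_upwards [hk] with t ht
    rw [SimpleFunc.map_apply, ht]
    have := (Nat.lt_floor_add_one (‖f t‖ / ε)).le
    rw [div_le_iff₀ hε] at this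
    rw [NNReal.coe_mul, NNReal.coe_natCast, Real.coe_toNNReal _ hε.le]
    rw [add_mul, one_mul] at this
    exact this

namespace IsDominatingGaugeNorm

variable {α : LInf → ℝ} (hα : IsDominatingGaugeNorm α)
include hα

theorem gaugeExt_coe (f : LInf) : gaugeExt α f = ENNReal.ofReal (α f) := by
  apply le_antisymm
  · refine iSup₂_le fun s hs => ENNReal.ofReal_le_ofReal (hα.mono ?_)
    filter_upwards [hs, coeFn_simpleToLInf s] with t h1 h2
    rw [h2]
    have h1' : (s t : ℝ) ≤ ‖f t‖ := h1
    simpa using h1'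
  · refine ENNReal.le_of_forall_pos_le_add fun ε hε _ => ?_
    obtain ⟨s, hs, hs'⟩ := exists_simpleFunc_approx f.2 (show (0 : ℝ) < ε from hε)
    have h1 : α f ≤ α (simpleToLInf s) + ε := by
      set E : LInf := (ε : ℂ) • chi Set.univ MeasurableSet.univ with hE
      have h2 : α f ≤ α (simpleToLInf s + E) := hα.mono (by
        filter_upwards [hs', coeFn_simpleToLInf s, Lp.coeFn_add (simpleToLInf s) E,
          Lp.coeFn_smul (ε : ℂ) (chi Set.univ MeasurableSet.univ),
          (indicatorConstLp_coeFn (p := ∞) (hs := MeasurableSet.univ)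
            (hμs := measure_ne_top haar Set.univ) (c := (1 : ℂ)))] with t h1 h2 h3 h4 h5
        rw [h3, Pi.add_apply, h2, hE, h4, Pi.smul_apply, chi, h5]
        have : ((s t : ℝ) : ℂ) + (ε : ℂ) • Set.univ.indicator (fun _ : Torus => (1 : ℂ)) t
            = ((s t + ε : ℝ) : ℂ) := by simp
        rw [this, Complex.norm_real, Real.norm_of_nonneg (by positivity)]
        exact h1)
      have h3 := hα.add_le (simpleToLInf s) E
      rw [hE, hα.smul_eq, hα.one_eq] at h3
      have : ‖((ε : ℝ) : ℂ)‖ = ε := by simp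
      rw [this] at h3
      linarith
    calc ENNReal.ofReal (α f) ≤ ENNReal.ofReal (α (simpleToLInf s) + ε) :=
          ENNReal.ofReal_le_ofReal h1
      _ = ENNReal.ofReal (α (simpleToLInf s)) + ε := by
          rw [ENNReal.ofReal_add (hα.nonneg _) (by positivity), ENNReal.ofReal_coe_nnreal]
      _ ≤ gaugeExt α f + ε := by
          gcongr
          exact le_iSup₂_of_le (f := fun (s : SimpleFunc Torus ℝ≥0)
            (_ : ∀ᵐ t ∂haar, s t ≤ ‖(f : LZero) t‖₊) => ENNReal.ofReal (α (simpleToLInf s)))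
            s hs le_rfl

theorem gaugeExt_le_of_bound {f : LZero} {C : ℝ} (hC : 0 ≤ C) (h : ∀ᵐ t ∂haar, ‖f t‖ ≤ C) :
    gaugeExt α f ≤ ENNReal.ofReal C := by
  have := hα.gaugeExt_coe ⟨f, mem_LInfSet_of_bound C h⟩
  rw [this]
  exact ENNReal.ofReal_le_ofReal (hα.le_of_bound hC h)

theorem gaugeExt_lt_top {f : LZero} (hf : f ∈ LInfSet) : gaugeExt α f < ∞ := by
  rw [hα.gaugeExt_coe ⟨f, hf⟩]
  exact ENNReal.ofReal_lt_top

theorem gaugeExt_zero : gaugeExt α 0 = 0 := by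
  have := hα.gaugeExt_le_of_bound (f := 0) le_rfl (by
    filter_upwards [AEEqFun.coeFn_zero (α := Torus) (β := ℂ) (μ := haar)] with t ht
    rw [ht]; simp)
  simpa using this

theorem lintegral_le_gaugeExt (f : LZero) : ∫⁻ t, ‖f t‖ₑ ∂haar ≤ gaugeExt α f := by
  have : ∫⁻ t, ‖f t‖ₑ ∂haar = ∫⁻ t, (‖f t‖₊ : ℝ≥0∞) ∂haar := rfl
  rw [this, lintegral_eq_nnreal]
  refine iSup₂_le fun s hs => ?_
  have h1 : ∀ᵐ t ∂haar, s t ≤ ‖f t‖₊ := ae_of_all _ fun t => by exact_mod_cast hs t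
  refine le_iSup₂_of_le (f := fun (s : SimpleFunc Torus ℝ≥0)
            (_ : ∀ᵐ t ∂haar, s t ≤ ‖(f : LZero) t‖₊) => ENNReal.ofReal (α (simpleToLInf s)))
            s h1 ?_
  refine le_trans ?_ (ENNReal.ofReal_le_ofReal (hα.norm_one_le (simpleToLInf s)))
  rw [ofReal_integral_norm_eq_lintegral_enorm
    ((Lp.memLp (simpleToLInf s)).integrable le_top)]
  rw [← SimpleFunc.lintegral_eq_lintegral]
  apply le_of_eq
  refine lintegral_congr_ae ?_
  filter_upwards [coeFn_simpleToLInf s] with t ht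
  rw [ht]
  simp [enorm_eq_nnnorm]

/-- Each simple `s ≤ |f|` splits as `min s |g|` plus a remainder that is at most `|h|`; the summands
are bounded, so the triangle inequality on `L^∞` applies to them. -/
theorem gaugeExt_le_add {f g h : LZero} (hfgh : ∀ᵐ t ∂haar, ‖f t‖ ≤ ‖g t‖ + ‖h t‖) :
    gaugeExt α f ≤ gaugeExt α g + gaugeExt α h := by
  refine iSup₂_le fun s hs => ?_
  have hg : Measurable g := g.measurable
  have hsm : Measurable s := s.measurable
  let F : Torus → ℂ := fun t => ((min (s t : ℝ) ‖g t‖ : ℝ) : ℂ)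
  let G : Torus → ℂ := fun t => ((s t - min (s t : ℝ) ‖g t‖ : ℝ) : ℂ)
  have hF : Measurable F := by
    have : Measurable fun t => min (s t : ℝ) ‖g t‖ := (hsm.coe_nnreal_real).min hg.norm
    fun_prop
  have hG : Measurable G := by
    have : Measurable fun t => min (s t : ℝ) ‖g t‖ := (hsm.coe_nnreal_real).min hg.norm
    fun_prop
  obtain ⟨C, -, hC⟩ := exists_bound_of_mem_LInfSet (simpleToLInf s).2
  have hC' : ∀ᵐ t ∂haar, (s t : ℝ) ≤ C := by
    filter_upwards [hC, coeFn_simpleToLInf s] with t h1 h2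
    rw [h2] at h1
    simpa using h1
  have nF : ∀ t, ‖F t‖ = min (s t : ℝ) ‖g t‖ := fun t => by
    rw [Complex.norm_real, Real.norm_of_nonneg (le_min (by positivity) (by positivity))]
  have nG : ∀ t, ‖G t‖ = s t - min (s t : ℝ) ‖g t‖ := fun t => by
    rw [Complex.norm_real, Real.norm_of_nonneg (sub_nonneg.2 (min_le_left _ _))]
  have bF : ∀ᵐ t ∂haar, ‖F t‖ ≤ C := by
    filter_upwards [hC'] with t ht
    rw [nF]
    exact (min_le_left _ _).trans ht
  have bG : ∀ᵐ t ∂haar, ‖G t‖ ≤ C := by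
    filter_upwards [hC'] with t ht
    rw [nG]
    have : 0 ≤ min (s t : ℝ) ‖g t‖ := le_min (by positivity) (by positivity)
    linarith
  let F' := ofBdd F hF.aestronglyMeasurable C bF
  let G' := ofBdd G hG.aestronglyMeasurable C bG
  have eF : (F' : Torus → ℂ) =ᵐ[haar] F := coeFn_ofBdd _ _ _ _
  have eG : (G' : Torus → ℂ) =ᵐ[haar] G := coeFn_ofBdd _ _ _ _
  have h1 : α (simpleToLInf s) ≤ α (F' + G') := hα.mono (by
    filter_upwards [eF, eG, coeFn_simpleToLInf s, Lp.coeFn_add F' G'] with t h1 h2 h3 h4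
    rw [h3, h4, Pi.add_apply, h1, h2]
    simp [F, G])
  have h2 : ENNReal.ofReal (α F') ≤ gaugeExt α g := by
    rw [← hα.gaugeExt_coe]
    refine gaugeExt_mono ?_
    filter_upwards [eF] with t ht
    rw [ht, nF]
    exact min_le_right _ _
  have h3 : ENNReal.ofReal (α G') ≤ gaugeExt α h := by
    rw [← hα.gaugeExt_coe]
    refine gaugeExt_mono ?_
    filter_upwards [eG, hs, hfgh] with t ht h1 h2
    rw [ht, nG]
    have h1' : (s t : ℝ) ≤ ‖f t‖ := h1
    rcases min_cases (s t : ℝ) ‖g t‖ with h | h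
    · rw [h.1]; simp
    · rw [h.1]; linarith
  calc ENNReal.ofReal (α (simpleToLInf s)) ≤ ENNReal.ofReal (α F' + α G') :=
        ENNReal.ofReal_le_ofReal (h1.trans (hα.add_le _ _))
    _ = ENNReal.ofReal (α F') + ENNReal.ofReal (α G') :=
        ENNReal.ofReal_add (hα.nonneg _) (hα.nonneg _)
    _ ≤ _ := add_le_add h2 h3

/-- Integer factors suffice for every later estimate and need only the triangle inequality, so
homogeneity of the extension is never required. -/
theorem gaugeExt_le_nat_mul {f : LZero} (n : ℕ) {g : LZero}
    (hg : ∀ᵐ t ∂haar, ‖g t‖ ≤ n * ‖f t‖) : gaugeExt α g ≤ n * gaugeExt α f := by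
  induction n generalizing g with
  | zero =>
    refine (hα.gaugeExt_le_of_bound (f := g) le_rfl ?_).trans (by simp)
    simpa using hg
  | succ k ih =>
    have h1 : ∀ᵐ t ∂haar, ‖((k : ℂ) • f) t‖ = k * ‖f t‖ := by
      filter_upwards [AEEqFun.coeFn_smul (k : ℂ) f] with t ht
      rw [ht]; simp
    refine (hα.gaugeExt_le_add (g := (k : ℂ) • f) (h := f) ?_).trans ?_
    · filter_upwards [hg, h1] with t h2 h3
      rw [h3]
      push_cast at h2
      linarith
    · push_cast
      rw [add_mul, one_mul]
      gcongr
      exact ih (h1.mono fun t ht => ht.le)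

/-- Dominated convergence for the gauge norm. -/
theorem tendsto_gaugeExt_zero (hcont : IsContinuousGauge α) {f : LZero} (hf : f ∈ LGauge α)
    (n : ℕ) {g : ℕ → LZero} (hb : ∀ i, ∀ᵐ t ∂haar, ‖g i t‖ ≤ n * ‖f t‖)
    (hg : ∀ᵐ t ∂haar, Tendsto (fun i => g i t) atTop (𝓝 0)) :
    Tendsto (fun i => gaugeExt α (g i)) atTop (𝓝 0) := by
  -- With `k` bounded and `α`-close to `f`, and `E` the set where `|g i| ≥ ε / 2`, there holds `|g
  -- i| ≤ n |f - k| + n K χ_E + ε`. The three terms cost `n ε`, `ε` and `ε`.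
  have key : ∀ ε : ℝ≥0, 0 < ε → ∀ᶠ i in atTop, gaugeExt α (g i) ≤ (n + 2 : ℝ≥0) * ε := by
    intro ε hε
    obtain ⟨k, hk, hfk⟩ := hf.2 ε (by exact_mod_cast hε)
    obtain ⟨K, hK, hkK⟩ := exists_bound_of_mem_LInfSet hk
    -- This tolerance makes `n K α(χ_E) ≤ ε`; the `+ 1` covers `n = 0`.
    obtain ⟨δ, hδ, hE⟩ := hcont (ε / (n * K + 1)) (by positivity)
    have hm := tendstoInMeasure_of_tendsto_ae (μ := haar) (f := fun i => (g i : Torus → ℂ))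
      (g := 0) (fun i => (g i).aestronglyMeasurable) hg
    have hm2 := tendstoInMeasure_iff_norm.1 hm (ε / 2) (by positivity)
    have hm3 := hm2.eventually_lt_const (show (0 : ℝ≥0∞) < ENNReal.ofReal δ by simpa using hδ)
    filter_upwards [hm3] with i hi
    set E : Set Torus := {t | (ε / 2 : ℝ) ≤ ‖g i t - (0 : Torus → ℂ) t‖} with hEdef
    have hEm : MeasurableSet E := by
      have h1 : Measurable (g i) := (g i).measurable
      have h2 : E = {t | (ε / 2 : ℝ) ≤ ‖g i t‖} := by ext t; simp [hEdef]
      rw [h2]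
      exact measurableSet_le measurable_const h1.norm
    have hχ := hE E hEm (by
      rw [Measure.real]
      exact (ENNReal.toReal_lt_of_lt_ofReal hi))
    have hχv : (chi E hEm : Torus → ℂ) =ᵐ[haar] E.indicator fun _ => (1 : ℂ) :=
      indicatorConstLp_coeFn
    let X : LInf := ((n * K : ℝ) : ℂ) • chi E hEm
    have hX : ∀ᵐ t ∂haar, ‖X t‖ = n * K * E.indicator (fun _ => (1 : ℝ)) t := by
      filter_upwards [hχv, Lp.coeFn_smul ((n * K : ℝ) : ℂ) (chi E hEm)] with t h1 h2
      rw [h2, Pi.smul_apply, h1]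
      by_cases ht : t ∈ E
      · simp [ht, abs_of_pos hK]
      · simp [ht]
    have hXα : gaugeExt α X ≤ ε := by
      rw [hα.gaugeExt_coe, hα.smul_eq, ← ENNReal.ofReal_coe_nnreal]
      apply ENNReal.ofReal_le_ofReal
      have h1 : ‖((n * K : ℝ) : ℂ)‖ = n * K := by
        rw [Complex.norm_real, Real.norm_of_nonneg (by positivity)]
      rw [h1]
      have h2 : n * K * α (chi E hEm) ≤ n * K * (ε / (n * K + 1)) := by gcongr
      refine h2.trans ?_
      rw [← mul_div_assoc, div_le_iff₀ (by positivity)]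
      nlinarith [ε.2, show (0 : ℝ) < ε from hε]
    let c : LZero := AEEqFun.mk (fun _ => ((ε : ℝ) : ℂ)) aestronglyMeasurable_const
    have hc : ∀ᵐ t ∂haar, ‖c t‖ = ε := by
      filter_upwards [AEEqFun.coeFn_mk (μ := haar) (fun _ : Torus => ((ε : ℝ) : ℂ))
        aestronglyMeasurable_const] with t ht
      rw [ht]; simp
    have hcα : gaugeExt α c ≤ ε := by
      have := hα.gaugeExt_le_of_bound (f := c) ε.2 (hc.mono fun t h => h.le)
      simpa using this
    let F : LZero := (n : ℂ) • (f - k)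
    have hF : ∀ᵐ t ∂haar, ‖F t‖ = n * ‖(f - k) t‖ := by
      filter_upwards [AEEqFun.coeFn_smul (n : ℂ) (f - k)] with t ht
      rw [ht]; simp
    have hFα : gaugeExt α F ≤ n * ε :=
      (hα.gaugeExt_le_nat_mul n (hF.mono fun t h => h.le)).trans (by gcongr)
    let Y : LZero := AEEqFun.mk (fun t => ((‖X t‖ + ‖c t‖ : ℝ) : ℂ))
      (Complex.continuous_ofReal.comp_aestronglyMeasurable
        ((X : LZero).aestronglyMeasurable.norm.add c.aestronglyMeasurable.norm))
    have hY : ∀ᵐ t ∂haar, ‖Y t‖ = ‖X t‖ + ‖c t‖ := by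
      filter_upwards [AEEqFun.coeFn_mk (μ := haar) (fun t => ((‖X t‖ + ‖c t‖ : ℝ) : ℂ))
        (Complex.continuous_ofReal.comp_aestronglyMeasurable
        ((X : LZero).aestronglyMeasurable.norm.add c.aestronglyMeasurable.norm))] with t ht
      rw [ht, Complex.norm_real, Real.norm_of_nonneg (by positivity)]
    have h1 : gaugeExt α (g i) ≤ gaugeExt α F + gaugeExt α Y := by
      apply hα.gaugeExt_le_add
      filter_upwards [hb i, hF, hX, hc, hY, hkK, AEEqFun.coeFn_sub f k]
        with t h1 h2 h3 h4 h5 h6 h7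
      rw [h5, h4, h3, h2, h7, Pi.sub_apply]
      by_cases ht : t ∈ E
      · have h8 : ‖f t‖ ≤ ‖f t - k t‖ + ‖k t‖ := norm_le_norm_sub_add _ _
        have h9 : (n : ℝ) * ‖f t‖ ≤ n * (‖f t - k t‖ + K) := by
          gcongr
          linarith
        simp only [ht, Set.indicator_of_mem, mul_one]
        have := ε.2
        linarith
      · have h8 : ‖g i t‖ < ε / 2 := by
          by_contra hcon
          exact ht (by simpa [hEdef] using hcon)
        simp only [ht, not_false_eq_true, Set.indicator_of_notMem, mul_zero, zero_add]
        have h9 : (0 : ℝ) ≤ n * ‖f t - k t‖ := by positivity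
        have := ε.2
        linarith
    have h2 : gaugeExt α Y ≤ gaugeExt α X + gaugeExt α c :=
      hα.gaugeExt_le_add (hY.mono fun t h => h.le)
    calc gaugeExt α (g i) ≤ n * ε + (ε + ε) :=
          h1.trans (add_le_add hFα (h2.trans (add_le_add hXα hcα)))
      _ = (n + 2 : ℝ≥0) * ε := by push_cast; ring
  rw [ENNReal.tendsto_nhds_zero]
  intro ε hε
  obtain ⟨r, hr, hrε⟩ := ENNReal.lt_iff_exists_nnreal_btwn.1 hε
  have hr' : 0 < r := by exact_mod_cast hr
  filter_upwards [key (r / (n + 2)) (by positivity)] with i hi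
  refine hi.trans (le_trans ?_ hrε.le)
  rw [← ENNReal.coe_mul, mul_div_cancel₀ _ (by positivity)]

end IsDominatingGaugeNorm

/-! ### Closures and multiplication by bounded functions -/

theorem gaugeClosure_mono {α : LInf → ℝ} {S T : Set LZero} (h : S ⊆ T) :
    gaugeClosure α S ⊆ gaugeClosure α T := fun _ hf =>
  ⟨hf.1, fun ε hε => (hf.2 ε hε).imp fun _ hg => ⟨h hg.1, hg.2⟩⟩

theorem mul_mem_LInfSet {f g : LZero} (hf : f ∈ LInfSet) (hg : g ∈ LInfSet) :
    f * g ∈ LInfSet := by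
  obtain ⟨C, hC, h1⟩ := exists_bound_of_mem_LInfSet hf
  obtain ⟨D, hD, h2⟩ := exists_bound_of_mem_LInfSet hg
  refine mem_LInfSet_of_bound (C * D) ?_
  filter_upwards [h1, h2, AEEqFun.coeFn_mul f g] with t h1 h2 h3
  rw [h3, Pi.mul_apply, norm_mul]
  gcongr

theorem gaugeClosure_mul {α : LInf → ℝ} {S T : Set LZero} {φ : LZero}
    (hφ : ∀ᵐ t ∂haar, ‖φ t‖ ≤ 1) (hST : ∀ f ∈ S, φ * f ∈ T) {f : LZero}
    (hf : f ∈ gaugeClosure α S) : φ * f ∈ gaugeClosure α T := by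
  refine ⟨(gaugeExt_mono ?_).trans_lt hf.1, fun ε hε => ?_⟩
  · filter_upwards [hφ, AEEqFun.coeFn_mul φ f] with t h1 h2
    rw [h2, Pi.mul_apply, norm_mul]
    exact mul_le_of_le_one_left (norm_nonneg _) h1
  · obtain ⟨g, hg, hfg⟩ := hf.2 ε hε
    refine ⟨φ * g, hST g hg, (gaugeExt_mono ?_).trans_lt hfg⟩
    filter_upwards [hφ, AEEqFun.coeFn_mul φ f, AEEqFun.coeFn_mul φ g,
      AEEqFun.coeFn_sub (φ * f) (φ * g), AEEqFun.coeFn_sub f g] with t h1 h2 h3 h4 h5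
    rw [h4, h5, Pi.sub_apply, Pi.sub_apply, h2, h3, Pi.mul_apply, Pi.mul_apply, ← mul_sub, norm_mul]
    exact mul_le_of_le_one_left (norm_nonneg _) h1

namespace IsDominatingGaugeNorm

variable {α : LInf → ℝ} (hα : IsDominatingGaugeNorm α)
include hα

theorem subset_gaugeClosure {S : Set LZero} (hS : S ⊆ LInfSet) : S ⊆ gaugeClosure α S :=
  fun f hf => ⟨hα.gaugeExt_lt_top (hS hf), fun ε hε => ⟨f, hf, by
    rwa [sub_self, hα.gaugeExt_zero]⟩⟩

theorem integrable_of_gaugeExt_lt_top {f : LZero} (hf : gaugeExt α f < ∞) : Integrable f haar :=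
  ⟨f.aestronglyMeasurable, (hα.lintegral_le_gaugeExt f).trans_lt hf⟩

theorem mul_mem_LGauge {b f : LZero} (hb : b ∈ LInfSet) (hf : f ∈ LGauge α) :
    b * f ∈ LGauge α := by
  obtain ⟨C, hC, h1⟩ := exists_bound_of_mem_LInfSet hb
  obtain ⟨n, hn⟩ := exists_nat_gt C
  have hn0 : (0 : ℝ) < n := hC.trans hn
  refine ⟨lt_of_le_of_lt (hα.gaugeExt_le_nat_mul (f := f) n ?_)
    (ENNReal.mul_lt_top (by simp) hf.1), fun ε hε => ?_⟩
  · filter_upwards [h1, AEEqFun.coeFn_mul b f] with t h1 h2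
    rw [h2, Pi.mul_apply, norm_mul]
    gcongr
    linarith
  · obtain ⟨g, hg, hfg⟩ := hf.2 (ε / n) (ENNReal.div_pos hε.ne' (by simp))
    refine ⟨b * g, mul_mem_LInfSet hb hg, ?_⟩
    refine lt_of_le_of_lt (hα.gaugeExt_le_nat_mul (f := f - g) n ?_) ?_
    · filter_upwards [h1, AEEqFun.coeFn_mul b f, AEEqFun.coeFn_mul b g,
        AEEqFun.coeFn_sub (b * f) (b * g), AEEqFun.coeFn_sub f g] with t h1 h2 h3 h4 h5
      rw [h4, h5, Pi.sub_apply, Pi.sub_apply, h2, h3, Pi.mul_apply, Pi.mul_apply, ← mul_sub,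
        norm_mul]
      gcongr
      linarith
    · have h0 : (n : ℝ≥0∞) ≠ 0 := by
        have : n ≠ 0 := by rintro rfl; simp at hn0
        exact_mod_cast this
      rw [mul_comm]
      exact (ENNReal.lt_div_iff_mul_lt (Or.inl h0) (Or.inl (by simp))).1 hfg

end IsDominatingGaugeNorm

/-- A dominated almost everywhere limit of elements of a closed subspace belongs to it. -/
theorem IsClosedSubspace.mem_of_ae_tendsto {α : LInf → ℝ} (hα : IsDominatingGaugeNorm α)
    (hcont : IsContinuousGauge α) {W : Submodule ℂ LZero} (hW : IsClosedSubspace α W)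
    {F f : LZero} {g : ℕ → LZero} (hF : F ∈ LGauge α) (hf : f ∈ LGauge α) (hg : ∀ i, g i ∈ W)
    (n : ℕ) (hb : ∀ i, ∀ᵐ t ∂haar, ‖f t - g i t‖ ≤ n * ‖F t‖)
    (ht : ∀ᵐ t ∂haar, Tendsto (fun i => g i t) atTop (𝓝 (f t))) : f ∈ W := by
  have hs : ∀ᵐ t ∂haar, ∀ i, (f - g i) t = f t - g i t :=
    ae_all_iff.2 fun i => AEEqFun.coeFn_sub f (g i)
  have := hα.tendsto_gaugeExt_zero hcont hF n (g := fun i => f - g i) (fun i => by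
    filter_upwards [hb i, hs] with t h1 h2
    rw [h2]
    exact h1) (by
    filter_upwards [hs, ht] with t h1 h2
    simp_rw [h1]
    simpa using (tendsto_const_nhds (x := f t)).sub h2)
  refine hW.closed f hf ⟨hf.1, fun ε hε => ?_⟩
  obtain ⟨i, hi⟩ := (this.eventually_lt_const hε).exists
  exact ⟨g i, hg i, hi⟩

/-! ### Fourier coefficients and shifts on `L²` -/

/-- Square integrable functions on the circle. -/
abbrev LTwo : Type := Lp ℂ 2 haar

theorem integrable_fourier_mul {a : Torus → ℂ} (ha : Integrable a haar) (n : ℤ) :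
    Integrable (fun t => fourier n t * a t) haar :=
  ha.fourier_smul n

/-- Integration against `a` is a continuous functional on `C(Torus, ℂ)`, and trigonometric
polynomials are dense there. -/
theorem integral_continuous_mul_eq_zero {a : Torus → ℂ} (ha : Integrable a haar)
    (h : ∀ n : ℤ, ∫ t, fourier n t * a t ∂haar = 0) (F : C(Torus, ℂ)) :
    ∫ t, F t * a t ∂haar = 0 := by
  have hi : ∀ F : C(Torus, ℂ), Integrable (fun t => F t * a t) haar := fun F =>
    ha.bdd_mul F.continuous.aestronglyMeasurable (ae_of_all _ F.norm_coe_le_norm)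
  let L : C(Torus, ℂ) →ₗ[ℂ] ℂ :=
    { toFun := fun F => ∫ t, F t * a t ∂haar
      map_add' := fun F G => by
        rw [← integral_add (hi F) (hi G)]
        simp [add_mul]
      map_smul' := fun c F => by
        simp [mul_assoc, integral_const_mul] }
  let Λ : C(Torus, ℂ) →L[ℂ] ℂ := L.mkContinuous (∫ t, ‖a t‖ ∂haar) fun F => by
    change ‖∫ t, F t * a t ∂haar‖ ≤ _
    rw [mul_comm (∫ t, ‖a t‖ ∂haar), ← integral_const_mul]
    refine (norm_integral_le_integral_norm _).trans (integral_mono (hi F).norm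
      (ha.norm.const_mul _) fun t => ?_)
    simp only [norm_mul]
    gcongr
    exact F.norm_coe_le_norm t
  have h1 : Submodule.span ℂ (Set.range (fourier (T := 2 * Real.pi))) ≤ Λ.ker := by
    rw [Submodule.span_le]
    rintro _ ⟨n, rfl⟩
    exact h n
  have h2 := Submodule.topologicalClosure_minimal _ h1 Λ.isClosed_ker
  rw [span_fourier_closure_eq_top] at h2
  exact h2 (Submodule.mem_top (x := F))

/-- An integrable function is determined by its Fourier coefficients. -/
theorem ae_eq_zero_of_integral_fourier {a : Torus → ℂ} (ha : Integrable a haar)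
    (h : ∀ n : ℤ, ∫ t, fourier n t * a t ∂haar = 0) : a =ᵐ[haar] 0 := by
  refine ae_eq_zero_of_forall_setIntegral_isClosed_eq_zero ha fun s hs => ?_
  -- Continuous functions with values in `[0, 1]` converging pointwise to the indicator of the
  -- closed set `s`.
  let F : ℕ → C(Torus, ℂ) := fun n => ⟨fun t => ((hs.apprSeq n t : ℝ) : ℂ), by fun_prop⟩
  have h1 : Tendsto (fun n => ∫ t, F n t * a t ∂haar) atTop
      (𝓝 (∫ t, s.indicator a t ∂haar)) := by
    refine tendsto_integral_of_dominated_convergence (fun t => ‖a t‖)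
      (fun n => (F n).continuous.aestronglyMeasurable.mul ha.1) ha.norm
      (fun n => ae_of_all _ fun t => ?_) (ae_of_all _ fun t => ?_)
    · rw [norm_mul]
      refine mul_le_of_le_one_left (norm_nonneg _) ?_
      change ‖((hs.apprSeq n t : ℝ) : ℂ)‖ ≤ 1
      rw [Complex.norm_real, Real.norm_of_nonneg (by positivity)]
      exact_mod_cast HasOuterApproxClosed.apprSeq_apply_le_one hs n t
    · have h2 := (tendsto_pi_nhds.1 (HasOuterApproxClosed.tendsto_apprSeq hs)) t
      have h3 : Tendsto (fun n => F n t) atTop (𝓝 (((s.indicator (fun _ => (1 : ℝ≥0)) t : ℝ≥0) : ℝ) : ℂ)) :=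
        (Complex.continuous_ofReal.tendsto _).comp ((NNReal.tendsto_coe).2 h2)
      convert h3.mul_const (a t) using 2
      by_cases ht : t ∈ s <;> simp [ht]
  simp_rw [integral_continuous_mul_eq_zero ha h] at h1
  rw [← integral_indicator hs.measurableSet]
  exact tendsto_nhds_unique h1 tendsto_const_nhds

/-- Multiplication by a bounded function, as an operator on `L²`. -/
def mulL (b : LInf) : LTwo →L[ℂ] LTwo := (ContinuousLinearMap.mul ℂ ℂ).holderL haar ∞ 2 2 b

theorem coeFn_mulL (b : LInf) (f : LTwo) : (mulL b f : Torus → ℂ) =ᵐ[haar] fun t => b t * f t :=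
  ContinuousLinearMap.coeFn_holder _ b f

/-- The exponential `z ^ n` as an element of `L^∞`. -/
def expo (n : ℤ) : LInf :=
  ofBdd (fourier n) (fourier n).continuous.aestronglyMeasurable 1
    (ae_of_all _ fun t => by rw [fourier_apply, Circle.norm_coe])

theorem coeFn_expo (n : ℤ) : (expo n : Torus → ℂ) =ᵐ[haar] fourier n := coeFn_ofBdd _ _ _ _

/-- Multiplication by `z ^ n` on `L²`. -/
def shift (n : ℤ) : LTwo →L[ℂ] LTwo := mulL (expo n)

theorem coeFn_shift (n : ℤ) (f : LTwo) :
    (shift n f : Torus → ℂ) =ᵐ[haar] fun t => fourier n t * f t := by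
  filter_upwards [coeFn_mulL (expo n) f, coeFn_expo n] with t h1 h2
  rw [shift, h1, h2]

theorem shift_shift (m n : ℤ) (f : LTwo) : shift m (shift n f) = shift (m + n) f := by
  apply Lp.ext
  filter_upwards [coeFn_shift m (shift n f), coeFn_shift n f, coeFn_shift (m + n) f] with t h1 h2 h3
  rw [h1, h2, h3, fourier_add, mul_assoc]

theorem shift_zero (f : LTwo) : shift 0 f = f := by
  apply Lp.ext
  filter_upwards [coeFn_shift 0 f] with t h1
  rw [h1, fourier_zero, one_mul]

theorem inner_shift (n : ℤ) (f g : LTwo) :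
    ⟪f, shift n g⟫_ℂ = ∫ t, fourier n t * (conj (f t) * g t) ∂haar := by
  rw [L2.inner_def]
  apply integral_congr_ae
  filter_upwards [coeFn_shift n g] with t h1
  rw [h1, RCLike.inner_apply]
  ring

theorem inner_shift_left (n : ℤ) (f g : LTwo) : ⟪shift n f, g⟫_ℂ = ⟪f, shift (-n) g⟫_ℂ := by
  rw [inner_shift, L2.inner_def]
  apply integral_congr_ae
  filter_upwards [coeFn_shift n f] with t h1
  rw [h1, RCLike.inner_apply, fourier_neg, map_mul]
  ring

theorem integrable_conj_mul (f g : LTwo) : Integrable (fun t => conj (f t) * g t) haar := by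
  have := L2.integrable_inner (𝕜 := ℂ) f g
  refine this.congr (ae_of_all _ fun t => ?_)
  change ⟪f t, g t⟫_ℂ = conj (f t) * g t
  rw [RCLike.inner_apply, mul_comm]

theorem integral_fourier_of_ne_zero {n : ℤ} (hn : n ≠ 0) :
    ∫ t : Torus, fourier n t ∂haar = 0 := by
  have h := congrFun (fourierCoeff_fourier (T := 2 * Real.pi) n) 0
  rw [fourierCoeff, Pi.single_eq_of_ne hn.symm] at h
  simpa using h

/-- A square integrable function orthogonal to its forward shifts has constant modulus. -/
theorem norm_sq_eq_of_inner_shift_eq_zero {φ : LTwo}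
    (h : ∀ n : ℤ, 0 < n → ⟪φ, shift n φ⟫_ℂ = 0) : ∀ᵐ t ∂haar, ‖φ t‖ ^ 2 = ‖φ‖ ^ 2 := by
  have hi := integrable_conj_mul φ φ
  -- Negative shifts follow from positive ones because the adjoint of `shift n` is `shift (-n)`.
  have h2 : ∀ n : ℤ, n ≠ 0 → ⟪φ, shift n φ⟫_ℂ = 0 := fun n hn => by
    rcases lt_or_gt_of_ne hn with h1 | h1
    · rw [← inner_conj_symm, inner_shift_left, h (-n) (by omega), map_zero]
    · exact h n h1
  have key := ae_eq_zero_of_integral_fourier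
    (a := fun t => conj (φ t) * φ t - ((‖φ‖ ^ 2 : ℝ) : ℂ))
    (hi.sub (integrable_const _)) fun n => by
      simp_rw [mul_sub]
      rw [integral_sub (integrable_fourier_mul hi n)
        (integrable_fourier_mul (integrable_const _) n), ← inner_shift, integral_mul_const]
      by_cases hn : n = 0
      · subst hn
        rw [shift_zero, inner_self_eq_norm_sq_to_K]
        simp
      · rw [h2 n hn, integral_fourier_of_ne_zero hn]
        simp
  filter_upwards [key] with t ht
  have h1 : conj (φ t) * φ t = ((‖φ‖ ^ 2 : ℝ) : ℂ) := sub_eq_zero.1 ht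
  rw [mul_comm, Complex.mul_conj, Complex.normSq_eq_norm_sq] at h1
  exact_mod_cast h1

/-! ### Fejér means and polynomial approximation in `H^∞` -/

theorem fourier_natCast_eq_pow (n : ℕ) (t : Torus) :
    fourier (n : ℤ) t = (AddCircle.toCircle t : ℂ) ^ n := by
  rw [fourier_apply, AddCircle.toCircle_zsmul]
  simp

/-- The sum of the Fejér-type kernel, written as an integral against a nonnegative weight. -/
theorem sum_fourierCoeff_sub_mul_fourier {h : Torus → ℂ} (hh : Integrable h haar) (N : ℕ)
    (t : Torus) :
    ∑ j ∈ Finset.range N, ∑ l ∈ Finset.range N,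
        fourierCoeff h ((j : ℤ) - l) * fourier ((j : ℤ) - l) t =
      ∫ s, ((‖∑ j ∈ Finset.range N, fourier (j : ℤ) t * fourier (-(j : ℤ)) s‖ ^ 2 : ℝ) : ℂ) * h s
        ∂haar := by
  have hi : ∀ j l : ℕ, Integrable (fun s =>
      fourier ((j : ℤ) - l) t * (fourier (-((j : ℤ) - l)) s * h s)) haar := fun j l =>
    (integrable_fourier_mul hh _).const_mul _
  have e : ∀ s, ((‖∑ j ∈ Finset.range N, fourier (j : ℤ) t * fourier (-(j : ℤ)) s‖ ^ 2 : ℝ) : ℂ)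
      * h s = ∑ j ∈ Finset.range N, ∑ l ∈ Finset.range N,
        fourier ((j : ℤ) - l) t * (fourier (-((j : ℤ) - l)) s * h s) := fun s => by
    rw [← Complex.normSq_eq_norm_sq, ← Complex.mul_conj, map_sum, Finset.sum_mul_sum,
      Finset.sum_mul]
    refine Finset.sum_congr rfl fun j _ => ?_
    rw [Finset.sum_mul]
    refine Finset.sum_congr rfl fun l _ => ?_
    rw [map_mul, fourier_neg (n := (l : ℤ)), Complex.conj_conj, sub_eq_add_neg, fourier_add,
      fourier_neg (n := (l : ℤ)), neg_add, neg_neg, fourier_add]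
    ring
  simp_rw [e]
  rw [integral_finsetSum _ fun j _ => integrable_finsetSum _ fun l _ => hi j l]
  refine Finset.sum_congr rfl fun j _ => ?_
  rw [integral_finsetSum _ fun l _ => hi j l]
  refine Finset.sum_congr rfl fun l _ => ?_
  rw [integral_const_mul, fourierCoeff, mul_comm]
  simp

/-- The kernel is nonnegative, and applying the same identity to the constant `1` shows that its
total mass is `N`. -/
theorem norm_sum_fourierCoeff_sub_mul_fourier_le {h : Torus → ℂ} (hh : Integrable h haar) {C : ℝ}
    (hC : ∀ᵐ t ∂haar, ‖h t‖ ≤ C) (N : ℕ) (t : Torus) :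
    ‖∑ j ∈ Finset.range N, ∑ l ∈ Finset.range N,
        fourierCoeff h ((j : ℤ) - l) * fourier ((j : ℤ) - l) t‖ ≤ N * C := by
  have h1 := sum_fourierCoeff_sub_mul_fourier (h := fun _ => (1 : ℂ)) (integrable_const _) N t
  have h2 : fourierCoeff (fun _ : Torus => (1 : ℂ)) = Pi.single 0 1 := by
    rw [← fourierCoeff_fourier (T := 2 * Real.pi) 0]
    congr 1
    funext s
    exact fourier_zero.symm
  have h3 : ∑ j ∈ Finset.range N, ∑ l ∈ Finset.range N,
      fourierCoeff (fun _ : Torus => (1 : ℂ)) ((j : ℤ) - l) * fourier ((j : ℤ) - l) t = N := by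
    rw [h2]
    have : ∀ j ∈ Finset.range N, ∑ l ∈ Finset.range N,
        (Pi.single 0 1 : ℤ → ℂ) ((j : ℤ) - l) * fourier ((j : ℤ) - l) t = 1 := fun j hj => by
      rw [Finset.sum_eq_single_of_mem j hj fun l _ hl => by
        rw [Pi.single_eq_of_ne (by omega), zero_mul]]
      simp
    rw [Finset.sum_congr rfl this]
    simp
  rw [h3] at h1
  simp only [mul_one] at h1
  rw [integral_complex_ofReal] at h1
  have h4 : ∫ s, ‖∑ j ∈ Finset.range N, fourier (j : ℤ) t * fourier (-(j : ℤ)) s‖ ^ 2 ∂haar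
      = (N : ℝ) := by exact_mod_cast h1.symm
  rw [sum_fourierCoeff_sub_mul_fourier hh, ← h4, ← integral_mul_const]
  have hint : Integrable (fun s =>
      ‖∑ j ∈ Finset.range N, fourier (j : ℤ) t * fourier (-(j : ℤ)) s‖ ^ 2) haar := by
    have hcont : Continuous fun s : Torus =>
      ‖∑ j ∈ Finset.range N, fourier (j : ℤ) t * fourier (-(j : ℤ)) s‖ ^ 2 := by fun_prop
    exact hcont.integrable_of_hasCompactSupport (HasCompactSupport.of_compactSpace _)
  refine (norm_integral_le_integral_norm _).trans
    (integral_mono_of_nonneg (ae_of_all _ fun _ => norm_nonneg _) (hint.mul_const C) ?_)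
  filter_upwards [hC] with s hs
  rw [norm_mul, Complex.norm_real, Real.norm_of_nonneg (by positivity)]
  gcongr

/-- For an analytic function, row `j` of the Fejér double sum is the partial sum with frequencies
`0, …, j`. The double sum is therefore `N` times the Cesàro mean. -/
theorem sum_range_sub_eq (c : ℤ → ℂ) (hc : ∀ n < 0, c n = 0) {j N : ℕ} (hj : j < N) :
    ∑ l ∈ Finset.range N, c ((j : ℤ) - l) = ∑ l ∈ Finset.range (j + 1), c l := by
  rw [← Finset.sum_range_reflect (fun l : ℕ => c l) (j + 1)]
  symm
  refine Finset.sum_subset_zero_on_sdiff (s₁ := Finset.range (j + 1)) (fun l hl => ?_) (fun l hl => ?_) fun l hl => ?_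
  · simp only [Finset.mem_range] at *; omega
  · simp only [Finset.mem_sdiff, Finset.mem_range] at hl
    exact hc _ (by omega)
  · simp only [Finset.mem_range] at hl
    congr 1
    omega

/-- A bounded analytic function is a boundedly almost everywhere limit of polynomials in `z`. -/
theorem exists_polynomial_tendsto {h : LZero} (hh : h ∈ HInfSet) {C : ℝ}
    (hC : ∀ᵐ t ∂haar, ‖h t‖ ≤ C) : ∃ p : ℕ → Polynomial ℂ,
      (∀ i t, ‖(p i).eval (AddCircle.toCircle (T := 2 * Real.pi) t : ℂ)‖ ≤ C) ∧
      ∀ᵐ t ∂haar, Tendsto (fun i => (p i).eval (AddCircle.toCircle t : ℂ)) atTop (𝓝 (h t)) := by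
  have hmem : MemLp h ∞ haar := Lp.mem_Lp_iff_memLp.1 hh.1
  have hint : Integrable h haar := hmem.integrable le_top
  have hmem2 : MemLp h 2 haar := hmem.mono_exponent le_top
  let H : LTwo := hmem2.toLp h
  have hH : (H : Torus → ℂ) =ᵐ[haar] h := hmem2.coeFn_toLp
  let a : ℤ → ℂ := fourierCoeff h
  have ha : fourierCoeff H = a := fourierCoeff_congr_ae hH
  let u : ℕ → C(Torus, ℂ) := fun j => ∑ l ∈ Finset.range (j + 1), a l • fourier (l : ℤ)
  let v : ℕ → C(Torus, ℂ) := fun N => (N : ℝ)⁻¹ • ∑ j ∈ Finset.range N, u j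
  let p : ℕ → Polynomial ℂ := fun N =>
    Polynomial.C ((N : ℂ)⁻¹) * ∑ j ∈ Finset.range N, ∑ l ∈ Finset.range (j + 1),
      Polynomial.C (a l) * Polynomial.X ^ l
  have hp : ∀ N t, (p N).eval (AddCircle.toCircle (T := 2 * Real.pi) t : ℂ) = v N t := fun N t => by
    simp [p, v, u, Polynomial.eval_finsetSum, ← fourier_natCast_eq_pow]
  let T : C(Torus, ℂ) →L[ℂ] LTwo := ContinuousMap.toLp 2 haar ℂ
  have hs : HasSum (fun i : ℕ => a i • fourierLp 2 (i : ℤ)) H := by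
    have h1 := hasSum_fourier_series_L2 H
    rw [ha] at h1
    refine (Function.Injective.hasSum_iff (Nat.cast_injective (R := ℤ)) fun n hn => ?_).2 h1
    have : n < 0 := by
      by_contra hcon
      exact hn ⟨n.toNat, by simp; omega⟩
    rw [show a n = 0 from hh.2 n this, zero_smul]
  have ht : Tendsto (fun j => T (u j)) atTop (𝓝 H) := by
    have h1 := hs.tendsto_sum_nat.comp (tendsto_add_atTop_nat 1)
    refine h1.congr fun j => ?_
    simp only [Function.comp, u, map_sum, map_smul]
    rfl
  have ht2 : Tendsto (fun N => T (v N)) atTop (𝓝 H) := by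
    refine ht.cesaro_smul.congr fun N => ?_
    have : v N = ((N : ℂ)⁻¹) • ∑ j ∈ Finset.range N, u j := by
      ext t
      simp [v]
    rw [this, map_smul, map_sum]
    rw [← Complex.ofReal_natCast, ← Complex.ofReal_inv, Complex.coe_smul]
    rfl
  -- The Cesàro means converge in `L²`, hence almost everywhere along a subsequence; the uniform
  -- bound by `C` is the Fejér estimate.
  obtain ⟨ns, -, hns⟩ := (tendstoInMeasure_of_tendsto_Lp ht2).exists_seq_tendsto_ae
  refine ⟨fun i => p (ns i), fun i t => ?_, ?_⟩
  · have hC0 : 0 ≤ C := by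
      obtain ⟨t, ht⟩ := hC.exists
      exact (norm_nonneg _).trans ht
    have h1 := norm_sum_fourierCoeff_sub_mul_fourier_le hint hC (ns i) t
    have h2 : ∑ j ∈ Finset.range (ns i), ∑ l ∈ Finset.range (ns i),
        fourierCoeff h ((j : ℤ) - l) * fourier ((j : ℤ) - l) t =
        ∑ j ∈ Finset.range (ns i), u j t := by
      refine Finset.sum_congr rfl fun j hj => ?_
      rw [sum_range_sub_eq (fun n => fourierCoeff h n * fourier n t)
        (fun n hn => by rw [hh.2 n hn, zero_mul]) (Finset.mem_range.1 hj)]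
      simp [u, a]
    rw [hp]
    simp only [v, ContinuousMap.smul_apply, ContinuousMap.sum_apply]
    rw [← h2, norm_smul, norm_inv, Real.norm_natCast]
    rcases Nat.eq_zero_or_pos (ns i) with h0 | h0
    · simp [h0, hC0]
    · rw [inv_mul_le_iff₀ (by exact_mod_cast h0)]
      exact h1
  · have hv : ∀ᵐ t ∂haar, ∀ i, T (v (ns i)) t = v (ns i) t :=
      ae_all_iff.2 fun i => ContinuousMap.coeFn_toLp (p := 2) (𝕜 := ℂ) haar (v (ns i))
    filter_upwards [hns, hv, hH] with t h1 h2 h3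
    simp_rw [hp, ← h2]
    rwa [← h3]

/-! ### Damping functions in `H^∞` -/

theorem shift_mem_topologicalClosure {K : Submodule ℂ LTwo} {n : ℤ}
    (hK : ∀ f ∈ K, shift n f ∈ K) {f : LTwo} (hf : f ∈ K.topologicalClosure) :
    shift n f ∈ K.topologicalClosure := by
  have h1 : K ≤ K.topologicalClosure.comap (shift n).toLinearMap := fun g hg =>
    K.le_topologicalClosure (hK g hg)
  exact Submodule.topologicalClosure_minimal _ h1
    (K.isClosed_topologicalClosure.preimage (shift n).continuous) hf

/-- This is `(1 + x)^(-1/2) ≥ 1 - x / 2`: one has `(1 + x)(1 - x/2)² = 1 - x² (3 - x) / 4`, and a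
counterexample would have `x < 2`. -/
theorem one_sub_half_le {x c : ℝ} (hx : 0 ≤ x) (hc : 0 ≤ c) (h : 1 ≤ (1 + x) * c ^ 2) :
    2 - 2 * c ≤ x := by
  by_contra hcon
  push Not at hcon
  have h1 : c < 1 - x / 2 := by linarith
  have h2 : c ^ 2 < (1 - x / 2) ^ 2 := by nlinarith
  nlinarith [sq_nonneg x, mul_nonneg hx (sq_nonneg x)]

/-- For integrable `g` there is a bounded analytic `h` with `|h|² = 1 / (1 + |g|)` which is close
to `1` in `L²` if `g` is close to `0` in `L¹`. -/
theorem exists_HInf_damping {g : LZero} (hg : Integrable g haar) : ∃ h : LZero, h ∈ HInfSet ∧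
    (∀ᵐ t ∂haar, ‖h t‖ ^ 2 * (1 + ‖g t‖) = 1) ∧
    Integrable (fun t => ‖h t - 1‖ ^ 2) haar ∧
    ∫ t, ‖h t - 1‖ ^ 2 ∂haar ≤ ∫ t, ‖g t‖ ∂haar := by
  have hgm : Measurable g := g.measurable
  let s : Torus → ℝ := fun t => Real.sqrt (1 + ‖g t‖)
  have hs2 : ∀ t, s t ^ 2 = 1 + ‖g t‖ := fun t => Real.sq_sqrt (by positivity)
  have hs1 : ∀ t, 1 ≤ s t := fun t => Real.one_le_sqrt.2 (by simp)
  have hs0 : ∀ t, s t ≠ 0 := fun t => (zero_lt_one.trans_le (hs1 t)).ne'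
  have hsm : Measurable s := by fun_prop
  have hsmc : Measurable fun t => (s t : ℂ) := by fun_prop
  have hrm : Measurable fun t => (((s t)⁻¹ : ℝ) : ℂ) := by fun_prop
  have hSmem : MemLp (fun t => (s t : ℂ)) 2 haar := by
    rw [memLp_two_iff_integrable_sq_norm hsmc.aestronglyMeasurable]
    have : Integrable (fun t => 1 + ‖g t‖) haar := (integrable_const _).add hg.norm
    refine this.congr (ae_of_all _ fun t => ?_)
    change 1 + ‖g t‖ = ‖(s t : ℂ)‖ ^ 2
    rw [Complex.norm_real, Real.norm_eq_abs, sq_abs, hs2]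
  have hr1 : ∀ t, ‖(((s t)⁻¹ : ℝ) : ℂ)‖ ≤ 1 := fun t => by
    rw [Complex.norm_real, Real.norm_of_nonneg (inv_nonneg.2 (zero_le_one.trans (hs1 t)))]
    exact inv_le_one_of_one_le₀ (hs1 t)
  have hRmem : MemLp (fun t => (((s t)⁻¹ : ℝ) : ℂ)) 2 haar :=
    (memLp_top_of_bound hrm.aestronglyMeasurable 1 (ae_of_all _ hr1)).mono_exponent le_top
  let S : LTwo := hSmem.toLp _
  let R : LTwo := hRmem.toLp _
  have eS : (S : Torus → ℂ) =ᵐ[haar] fun t => (s t : ℂ) := hSmem.coeFn_toLp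
  have eR : (R : Torus → ℂ) =ᵐ[haar] fun t => (((s t)⁻¹ : ℝ) : ℂ) := hRmem.coeFn_toLp
  have hSR : ∀ n : ℤ, ⟪S, shift n R⟫_ℂ = ∫ t : Torus, fourier n t ∂haar := fun n => by
    rw [inner_shift]
    apply integral_congr_ae
    filter_upwards [eS, eR] with t h1 h2
    rw [h1, h2, Complex.conj_ofReal, ← Complex.ofReal_mul, mul_inv_cancel₀ (hs0 t)]
    simp
  have hSnorm : ‖S‖ ^ 2 = 1 + ∫ t, ‖g t‖ ∂haar := by
    have h1 : ⟪S, S⟫_ℂ = ((∫ t, (1 + ‖g t‖) ∂haar : ℝ) : ℂ) := by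
      rw [L2.inner_def, ← integral_complex_ofReal]
      apply integral_congr_ae
      filter_upwards [eS] with t h1
      rw [h1, RCLike.inner_apply, Complex.conj_ofReal, ← Complex.ofReal_mul, ← sq, hs2]
    rw [inner_self_eq_norm_sq_to_K, integral_add (integrable_const _) hg.norm] at h1
    have h2 : ‖S‖ ^ 2 = (∫ _ : Torus, (1 : ℝ) ∂haar) + ∫ t, ‖g t‖ ∂haar :=
      Complex.ofReal_injective (by rw [← h1]; simp)
    simpa using h2
  -- With `R = (1 + |g|)^(-1/2)` and `S = 1 / R`, let `N` be the closed span of `z R, z² R, …` and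
  -- `ξ` the component of `R` orthogonal to `N`. Then `ξ` is orthogonal to its forward shifts, so it
  -- has constant modulus `c`.
  let N0 : Submodule ℂ LTwo := Submodule.span ℂ (Set.range fun n : ℕ => shift (n + 1) R)
  let N : Submodule ℂ LTwo := N0.topologicalClosure
  have : CompleteSpace N := N0.isClosed_topologicalClosure.completeSpace_coe
  have hRN : ∀ n : ℤ, 0 < n → shift n R ∈ N := fun n hn =>
    N0.le_topologicalClosure (Submodule.subset_span ⟨(n - 1).toNat, by
      have : (((n - 1).toNat : ℤ) + 1) = n := by omega
      simp only [this]⟩)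
  have hN : ∀ n : ℤ, 0 < n → ∀ f ∈ N, shift n f ∈ N := fun n hn f hf => by
    refine shift_mem_topologicalClosure (fun f hf => ?_) hf
    refine Submodule.span_induction ?_ ?_ ?_ ?_ hf
    · rintro _ ⟨k, rfl⟩
      refine Submodule.subset_span ⟨k + n.toNat, ?_⟩
      simp only [shift_shift]
      congr 2
      push_cast
      omega
    · simp
    · intro x y _ _ hx hy
      rw [map_add]
      exact add_mem hx hy
    · intro c x _ hx
      rw [map_smul]
      exact Submodule.smul_mem _ _ hx
  obtain ⟨y, hy, ξ, hξ, hR⟩ := N.exists_add_mem_mem_orthogonal R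
  have hξN : ∀ f ∈ N, ⟪ξ, f⟫_ℂ = 0 := fun f hf => Submodule.inner_left_of_mem_orthogonal hf hξ
  have hξR : ξ = R - y := by rw [hR]; abel
  have hξshift : ∀ n : ℤ, 0 < n → ⟪ξ, shift n ξ⟫_ℂ = 0 := fun n hn => by
    apply hξN
    rw [hξR, map_sub]
    exact sub_mem (hRN n hn) (hN n hn y hy)
  have hξn := norm_sq_eq_of_inner_shift_eq_zero hξshift
  have hSN : ∀ f ∈ N, ⟪S, f⟫_ℂ = 0 := by
    have h1 : N0 ≤ (innerSL ℂ S).ker := by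
      refine Submodule.span_le.2 ?_
      rintro _ ⟨k, rfl⟩
      change ⟪S, shift (k + 1) R⟫_ℂ = 0
      rw [hSR, integral_fourier_of_ne_zero (by omega)]
    exact fun f hf => Submodule.topologicalClosure_minimal _ h1 (innerSL ℂ S).isClosed_ker hf
  -- As `S R = 1`, `S` is orthogonal to `N` and pairs to `1` with `R`. Cauchy–Schwarz then bounds
  -- `c` below by `1 / ‖S‖`.
  have hSξ : ⟪S, ξ⟫_ℂ = 1 := by
    have := hSR 0
    rw [shift_zero] at this
    rw [hξR, inner_sub_right, hSN y hy, this]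
    simp
  set c : ℝ := ‖ξ‖ with hc
  have hcS : 1 ≤ ‖S‖ * c := by
    have := norm_inner_le_norm (𝕜 := ℂ) S ξ
    rwa [hSξ, norm_one] at this
  have hc0 : 0 < c := by
    rcases (norm_nonneg ξ).eq_or_lt with h | h
    · rw [hc, ← h] at hcS
      norm_num at hcS
    · exact h
  have hx0 : 0 ≤ ∫ t, ‖g t‖ ∂haar := integral_nonneg fun _ => norm_nonneg _
  have hineq : 2 - 2 * c ≤ ∫ t, ‖g t‖ ∂haar := by
    refine one_sub_half_le hx0 hc0.le ?_
    rw [← hSnorm, ← mul_pow]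
    exact one_le_pow₀ hcS
  have hξm : Measurable ξ := (Lp.stronglyMeasurable ξ).measurable
  have hconj : Measurable fun t => conj (ξ t) := Complex.continuous_conj.measurable.comp hξm
  -- The damping function is `conj ξ · R / c`: its modulus is `R`, its negative coefficients are
  -- multiples of `⟪ξ, z^n R⟫ = 0`, and its mean is `⟪ξ, R⟫ / c = c`.
  let F : Torus → ℂ := fun t => (c : ℂ)⁻¹ * (conj (ξ t) * R t)
  have hRm : Measurable R := (Lp.stronglyMeasurable R).measurable
  have hF : Measurable F := (hconj.mul hRm).const_mul _
  let h : LZero := AEEqFun.mk F hF.aestronglyMeasurable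
  have hh : h =ᵐ[haar] F := AEEqFun.coeFn_mk _ _
  have hnorm : ∀ᵐ t ∂haar, ‖h t‖ = (s t)⁻¹ := by
    filter_upwards [hh, hξn, eR] with t h1 h2 h3
    have h4 : ‖ξ t‖ = c := (sq_eq_sq₀ (norm_nonneg _) (norm_nonneg _)).1 h2
    rw [h1]
    simp only [F]
    rw [norm_mul, norm_mul, RCLike.norm_conj, h4, h3, norm_inv, Complex.norm_real,
      Complex.norm_real, Real.norm_of_nonneg hc0.le,
      Real.norm_of_nonneg (inv_nonneg.2 (zero_le_one.trans (hs1 t)))]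
    field_simp
  have hle : ∀ᵐ t ∂haar, ‖h t‖ ≤ 1 := by
    filter_upwards [hnorm] with t ht
    rw [ht]
    exact inv_le_one_of_one_le₀ (hs1 t)
  have hint : ∀ n : ℤ, ∫ t, fourier n t * h t ∂haar = (c : ℂ)⁻¹ * ⟪ξ, shift n R⟫_ℂ := fun n => by
    rw [inner_shift, ← integral_const_mul]
    apply integral_congr_ae
    filter_upwards [hh] with t h1
    rw [h1]
    simp only [F]
    ring
  have hLinf : h ∈ LInfSet := mem_LInfSet_of_bound 1 hle
  have hhI : Integrable h haar := (Lp.mem_Lp_iff_memLp.1 hLinf).integrable le_top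
  have h0 : ∫ t, h t ∂haar = c := by
    have h1 := hint 0
    simp only [fourier_zero, one_mul, shift_zero] at h1
    rw [h1]
    have h2 : R = y + ξ := hR
    rw [h2, inner_add_right, hξN y hy, inner_self_eq_norm_sq_to_K, ← hc, zero_add]
    have : (c : ℂ) ≠ 0 := by exact_mod_cast hc0.ne'
    simp only [Complex.coe_algebraMap]
    field_simp
  -- Since `|h| ≤ 1`, expanding the square gives `|h - 1|² ≤ 2 - 2 Re h`, whose integral is `2 -
  -- 2c`.
  have hsq : ∀ᵐ t ∂haar, ‖h t - 1‖ ^ 2 ≤ 2 - 2 * (h t).re := by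
    filter_upwards [hle] with t ht
    rw [← Complex.normSq_eq_norm_sq, Complex.normSq_apply]
    have h2 : (h t).re * (h t).re + (h t).im * (h t).im ≤ 1 := by
      rw [← Complex.normSq_apply, Complex.normSq_eq_norm_sq]
      exact pow_le_one₀ (norm_nonneg _) ht
    simp only [Complex.sub_re, Complex.one_re, Complex.sub_im, Complex.one_im]
    nlinarith
  have hre : Integrable (fun t => (h t).re) haar := hhI.re
  have hreI : Integrable (fun t => 2 - 2 * (h t).re) haar :=
    (integrable_const _).sub (hre.const_mul 2)
  have hsqI : Integrable (fun t => ‖h t - 1‖ ^ 2) haar := by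
    refine hreI.mono' ?_ ?_
    · have : Measurable h := h.measurable
      exact ((this.sub_const 1).norm.pow_const 2).aestronglyMeasurable
    · filter_upwards [hsq] with t ht
      rwa [Real.norm_of_nonneg (by positivity)]
  refine ⟨h, ⟨hLinf, fun n hn => ?_⟩, ?_, hsqI, ?_⟩
  · rw [fourierCoeff]
    simp only [smul_eq_mul]
    rw [hint, hξN _ (hRN _ (by omega)), mul_zero]
  · filter_upwards [hnorm] with t ht
    rw [ht, ← hs2]
    have := hs0 t
    field_simp
  · refine (integral_mono_ae hsqI hreI hsq).trans ?_
    rw [integral_sub (integrable_const _) (hre.const_mul 2), integral_const_mul]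
    have h1 : ∫ t, (h t).re ∂haar = c := by
      have := integral_re hhI
      rw [show ∫ t, (h t).re ∂haar = ∫ t, RCLike.re (h t) ∂haar from rfl, this, h0]
      simp
    rw [h1]
    simpa using hineq

/-! ### Invariant subspaces as modules over `H^∞` -/

theorem coeFn_zfun : (zfun : Torus → ℂ) =ᵐ[haar] fun t => (AddCircle.toCircle t : ℂ) :=
  AEEqFun.coeFn_mk _ _

/-- A polynomial in `z`. -/
def polyFun (p : Polynomial ℂ) : LZero :=
  AEEqFun.mk (fun t : Torus => p.eval (AddCircle.toCircle t : ℂ))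
    (Continuous.aestronglyMeasurable (by fun_prop))

theorem coeFn_polyFun (p : Polynomial ℂ) :
    (polyFun p : Torus → ℂ) =ᵐ[haar] fun t => p.eval (AddCircle.toCircle t : ℂ) :=
  AEEqFun.coeFn_mk _ _

theorem polyFun_mul_mem {W : Submodule ℂ LZero} (hz : mulSet zfun W ⊆ W) (p : Polynomial ℂ)
    {w : LZero} (hw : w ∈ W) : polyFun p * w ∈ W := by
  have hpow : ∀ n : ℕ, zfun ^ n * w ∈ W := fun n => by
    induction n with
    | zero => simpa using hw
    | succ k ih =>
      rw [pow_succ', mul_assoc]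
      exact hz ⟨_, ih, rfl⟩
  induction p using Polynomial.induction_on' with
  | add p q hp hq =>
    have : polyFun (p + q) * w = polyFun p * w + polyFun q * w := by
      apply AEEqFun.ext
      filter_upwards [AEEqFun.coeFn_mul (polyFun (p + q)) w, AEEqFun.coeFn_mul (polyFun p) w,
        AEEqFun.coeFn_mul (polyFun q) w, AEEqFun.coeFn_add (polyFun p * w) (polyFun q * w),
        coeFn_polyFun p, coeFn_polyFun q, coeFn_polyFun (p + q)] with t h1 h2 h3 h4 h5 h6 h7
      rw [h1, h4, Pi.add_apply, h2, h3, Pi.mul_apply, Pi.mul_apply, Pi.mul_apply, h5, h6, h7,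
        Polynomial.eval_add, add_mul]
    rw [this]
    exact add_mem hp hq
  | monomial n a =>
    have : polyFun (Polynomial.monomial n a) * w = a • (zfun ^ n * w) := by
      apply AEEqFun.ext
      filter_upwards [AEEqFun.coeFn_mul (polyFun (Polynomial.monomial n a)) w,
        coeFn_polyFun (Polynomial.monomial n a), AEEqFun.coeFn_smul a (zfun ^ n * w),
        AEEqFun.coeFn_mul (zfun ^ n) w, AEEqFun.coeFn_pow zfun n, coeFn_zfun]
        with t h1 h2 h3 h4 h5 h6
      rw [h1, h3, Pi.smul_apply, h4, Pi.mul_apply, Pi.mul_apply, h5, h2, Pi.pow_apply, h6,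
        Polynomial.eval_monomial, smul_eq_mul, mul_assoc]
    rw [this]
    exact W.smul_mem _ (hpow n)

/-- Polynomials in `z` preserve `W`, and those approximating `h` are uniformly bounded, so the
products with `w` converge under a bound by a multiple of `|w|`. -/
theorem HInf_mul_mem {α : LInf → ℝ} (hα : IsDominatingGaugeNorm α) (hcont : IsContinuousGauge α)
    {W : Submodule ℂ LZero} (hW : IsClosedSubspace α W) (hz : mulSet zfun W ⊆ W)
    {h w : LZero} (hh : h ∈ HInfSet) (hw : w ∈ W) : h * w ∈ W := by
  obtain ⟨C, hC, hhC⟩ := exists_bound_of_mem_LInfSet hh.1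
  obtain ⟨p, hp, hlim⟩ := exists_polynomial_tendsto hh hhC
  obtain ⟨n, hn⟩ := exists_nat_ge (C + C)
  have hwL := hW.subset_LGauge hw
  have hpw : ∀ᵐ t ∂haar, ∀ i, (polyFun (p i) * w) t =
      (p i).eval (AddCircle.toCircle t : ℂ) * w t := ae_all_iff.2 fun i => by
    filter_upwards [AEEqFun.coeFn_mul (polyFun (p i)) w, coeFn_polyFun (p i)] with t h1 h2
    rw [h1, Pi.mul_apply, h2]
  refine hW.mem_of_ae_tendsto hα hcont (F := w) hwL (hα.mul_mem_LGauge hh.1 hwL)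
    (fun i => polyFun_mul_mem hz (p i) hw) n (fun i => ?_) ?_
  · filter_upwards [hpw, AEEqFun.coeFn_mul h w, hhC] with t h1 h2 h3
    rw [h1, h2, Pi.mul_apply, ← sub_mul, norm_mul]
    gcongr
    exact (norm_sub_le _ _).trans ((add_le_add h3 (hp i t)).trans hn)
  · filter_upwards [hpw, AEEqFun.coeFn_mul h w, hlim] with t h1 h2 h3
    rw [h2, Pi.mul_apply]
    simp_rw [h1]
    exact h3.mul_const _

/-! ### Passage between `W` and the `L²`-closure of its bounded part -/

theorem exists_damping_sequence {g : ℕ → LZero} (hg : ∀ i, Integrable (g i) haar)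
    (h0 : Tendsto (fun i => ∫ t, ‖g i t‖ ∂haar) atTop (𝓝 0)) :
    ∃ (ns : ℕ → ℕ) (h : ℕ → LZero), StrictMono ns ∧ (∀ i, h i ∈ HInfSet) ∧
      (∀ i, ∀ᵐ t ∂haar, ‖h i t‖ ^ 2 * (1 + ‖g (ns i) t‖) = 1) ∧
      ∀ᵐ t ∂haar, Tendsto (fun i => h i t) atTop (𝓝 1) := by
  choose h hH hnorm hint hle using fun i => exists_HInf_damping (hg i)
  have h1 : Tendsto (fun i => ∫ t, ‖h i t - 1‖ ^ 2 ∂haar) atTop (𝓝 0) :=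
    squeeze_zero (fun i => integral_nonneg fun t => by positivity) hle h0
  have hm : TendstoInMeasure haar (fun i t => ‖h i t - 1‖ ^ 2) atTop (fun _ => (0 : ℝ)) := by
    refine tendstoInMeasure_of_tendsto_eLpNorm (p := 1) one_ne_zero (fun i => (hint i).1)
      aestronglyMeasurable_const ?_
    have h2 := ENNReal.tendsto_ofReal h1
    rw [ENNReal.ofReal_zero] at h2
    refine h2.congr fun i => ?_
    rw [eLpNorm_one_eq_lintegral_enorm]
    have h3 := ofReal_integral_norm_eq_lintegral_enorm (hint i)
    simp only [norm_pow, norm_norm] at h3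
    rw [h3]
    simp
  obtain ⟨ns, hns, hlim⟩ := hm.exists_seq_tendsto_ae
  refine ⟨ns, fun i => h (ns i), hns, fun i => hH _, fun i => hnorm _, ?_⟩
  filter_upwards [hlim] with t ht
  have h2 : Tendsto (fun i => ‖h (ns i) t - 1‖) atTop (𝓝 0) := by
    have := (Real.continuous_sqrt.tendsto 0).comp ht
    rw [Real.sqrt_zero] at this
    refine this.congr fun i => ?_
    exact Real.sqrt_sq (norm_nonneg _)
  exact tendsto_iff_norm_sub_tendsto_zero.2 h2

theorem coeFn_mul_mul (h f : LZero) :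
    (h * (h * f) : LZero) =ᵐ[haar] fun t => h t ^ 2 * f t := by
  filter_upwards [AEEqFun.coeFn_mul h (h * f), AEEqFun.coeFn_mul h f] with t h1 h2
  rw [h1, Pi.mul_apply, h2, Pi.mul_apply, sq, mul_assoc]

/-- Damp `f / (i + 1)`: then `|h² f| = |f| / (1 + |f| / (m + 1))`, with `m = ns i`, is at most both
`|f|` and `m + 1`, while `h → 1`. -/
theorem exists_bounded_approx {α : LInf → ℝ} (hα : IsDominatingGaugeNorm α)
    (hcont : IsContinuousGauge α) {W : Submodule ℂ LZero} (hW : IsClosedSubspace α W)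
    (hz : mulSet zfun W ⊆ W) {f : LZero} (hf : f ∈ W) :
    ∃ k : ℕ → LZero, (∀ i, k i ∈ W ∧ k i ∈ LInfSet) ∧ (∀ i, ∀ᵐ t ∂haar, ‖k i t‖ ≤ ‖f t‖) ∧
      ∀ᵐ t ∂haar, Tendsto (fun i => k i t) atTop (𝓝 (f t)) := by
  have hfL := hW.subset_LGauge hf
  have hfI := hα.integrable_of_gaugeExt_lt_top hfL.1
  let g : ℕ → LZero := fun i => ((i + 1 : ℝ)⁻¹ : ℂ) • f
  have hgn : ∀ i, ∀ᵐ t ∂haar, ‖g i t‖ = (i + 1 : ℝ)⁻¹ * ‖f t‖ := fun i => by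
    filter_upwards [AEEqFun.coeFn_smul ((i + 1 : ℝ)⁻¹ : ℂ) f] with t ht
    have : ‖((i + 1 : ℝ)⁻¹ : ℂ)‖ = (i + 1 : ℝ)⁻¹ := by
      rw [norm_inv, Complex.norm_real, Real.norm_of_nonneg (by positivity)]
    rw [ht, Pi.smul_apply, norm_smul, this]
  have hgI : ∀ i, Integrable (g i) haar := fun i =>
    (hfI.smul ((i + 1 : ℝ)⁻¹ : ℂ)).congr (AEEqFun.coeFn_smul _ f).symm
  have hg0 : Tendsto (fun i => ∫ t, ‖g i t‖ ∂haar) atTop (𝓝 0) := by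
    have h1 : Tendsto (fun i : ℕ => (i + 1 : ℝ)⁻¹ * ∫ t, ‖f t‖ ∂haar) atTop (𝓝 0) := by
      have := (tendsto_one_div_add_atTop_nhds_zero_nat (𝕜 := ℝ)).mul_const (∫ t, ‖f t‖ ∂haar)
      simpa using this
    refine h1.congr fun i => ?_
    rw [← integral_const_mul]
    exact (integral_congr_ae (hgn i)).symm
  obtain ⟨ns, h, -, hH, hn, hlim⟩ := exists_damping_sequence hgI hg0
  have hk : ∀ᵐ t ∂haar, ∀ i, (h i * (h i * f) : LZero) t = h i t ^ 2 * f t :=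
    ae_all_iff.2 fun i => coeFn_mul_mul (h i) f
  have hle : ∀ i, ∀ᵐ t ∂haar, ‖(h i * (h i * f) : LZero) t‖ ≤ ‖f t‖ ∧
      ‖(h i * (h i * f) : LZero) t‖ ≤ ns i + 1 := fun i => by
    filter_upwards [hn i, hk, hgn (ns i)] with t h1 h2 h3
    rw [h2, norm_mul, norm_pow]
    rw [h3] at h1
    have h4 : (0 : ℝ) < ns i + 1 := by positivity
    have h5 : ‖h i t‖ ^ 2 * ((ns i + 1) + ‖f t‖) = ns i + 1 := by
      calc ‖h i t‖ ^ 2 * ((ns i + 1) + ‖f t‖)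
          = (ns i + 1) * (‖h i t‖ ^ 2 * (1 + (ns i + 1 : ℝ)⁻¹ * ‖f t‖)) := by field_simp
        _ = _ := by rw [h1, mul_one]
    have h6 : 0 ≤ ‖h i t‖ ^ 2 := by positivity
    have h7 := norm_nonneg (f t)
    have h8 : ‖h i t‖ ^ 2 ≤ 1 := by
      by_contra hcon
      push Not at hcon
      nlinarith
    constructor <;> nlinarith
  refine ⟨fun i => h i * (h i * f), fun i => ⟨?_, ?_⟩, fun i => (hle i).mono fun t ht => ht.1, ?_⟩
  · exact HInf_mul_mem hα hcont hW hz (hH i) (HInf_mul_mem hα hcont hW hz (hH i) hf)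
  · exact mem_LInfSet_of_bound (ns i + 1) ((hle i).mono fun t ht => ht.2)
  · filter_upwards [hk, hlim] with t h1 h2
    simp_rw [h1]
    simpa using (h2.pow 2).mul_const (f t)

theorem mem_gaugeClosure_bounded {α : LInf → ℝ} (hα : IsDominatingGaugeNorm α)
    (hcont : IsContinuousGauge α) {W : Submodule ℂ LZero} (hW : IsClosedSubspace α W)
    (hz : mulSet zfun W ⊆ W) {f : LZero} (hf : f ∈ W) :
    f ∈ gaugeClosure α {k | k ∈ W ∧ k ∈ LInfSet} := by
  obtain ⟨k, hk, hle, hlim⟩ := exists_bounded_approx hα hcont hW hz hf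
  have hfL := hW.subset_LGauge hf
  have hs : ∀ᵐ t ∂haar, ∀ i, (f - k i) t = f t - k i t :=
    ae_all_iff.2 fun i => AEEqFun.coeFn_sub f (k i)
  have := hα.tendsto_gaugeExt_zero hcont hfL 2 (g := fun i => f - k i) (fun i => by
    filter_upwards [hle i, hs] with t h1 h2
    rw [h2]
    have := norm_sub_le (f t) (k i t)
    push_cast
    linarith) (by
    filter_upwards [hs, hlim] with t h1 h2
    simp_rw [h1]
    simpa using (tendsto_const_nhds (x := f t)).sub h2)
  refine ⟨hfL.1, fun ε hε => ?_⟩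
  obtain ⟨i, hi⟩ := (this.eventually_lt_const hε).exists
  exact ⟨k i, hk i, hi⟩

/-- The bounded elements of `W`, as a subspace of `L²`. -/
def boundedPart (W : Submodule ℂ LZero) : Submodule ℂ LTwo where
  carrier := {f | (f : LZero) ∈ W ∧ (f : LZero) ∈ LInfSet}
  add_mem' := fun hf hg => ⟨W.add_mem hf.1 hg.1, (Lp ℂ ∞ haar).add_mem hf.2 hg.2⟩
  zero_mem' := ⟨W.zero_mem, (Lp ℂ ∞ haar).zero_mem⟩
  smul_mem' := fun c f hf => ⟨W.smul_mem c hf.1, Lp.const_smul_mem_Lp c ⟨(f : LZero), hf.2⟩⟩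

/-- If `x i → f` in `L²`, damping the errors `x i - f` by `h²` makes them bounded by `1`. The
products `h² x i` stay in `W` and are uniformly bounded because `f` is, so constants dominate the
convergence to `f`. -/
theorem mem_of_mem_closure_boundedPart {α : LInf → ℝ} (hα : IsDominatingGaugeNorm α)
    (hcont : IsContinuousGauge α) {W : Submodule ℂ LZero} (hW : IsClosedSubspace α W)
    (hz : mulSet zfun W ⊆ W) {f : LTwo} (hf : f ∈ (boundedPart W).topologicalClosure)
    (hfb : (f : LZero) ∈ LInfSet) : (f : LZero) ∈ W := by
  obtain ⟨x₀, hx₀, hxlim₀⟩ := mem_closure_iff_seq_limit.1 hf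
  obtain ⟨ms, hms, hae⟩ := (tendstoInMeasure_of_tendsto_Lp hxlim₀).exists_seq_tendsto_ae
  let x : ℕ → LTwo := fun i => x₀ (ms i)
  have hx : ∀ i, (x i : LZero) ∈ W := fun i => (hx₀ (ms i)).1
  have hxlim : Tendsto x atTop (𝓝 f) := hxlim₀.comp hms.tendsto_atTop
  let g : ℕ → LTwo := fun i => x i - f
  have hgI : ∀ i, Integrable (g i) haar := fun i => (Lp.memLp (g i)).integrable one_le_two
  have hg0 : Tendsto (fun i => ∫ t, ‖g i t‖ ∂haar) atTop (𝓝 0) := by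
    refine squeeze_zero (fun i => integral_nonneg fun t => norm_nonneg _) (fun i => ?_)
      (tendsto_iff_norm_sub_tendsto_zero.1 hxlim)
    have h1 : eLpNorm (g i) 1 haar ≤ eLpNorm (g i) 2 haar :=
      eLpNorm_le_eLpNorm_of_exponent_le one_le_two (Lp.aestronglyMeasurable _)
    have h2 := ENNReal.toReal_mono (Lp.eLpNorm_ne_top (g i)) h1
    rw [eLpNorm_one_eq_lintegral_enorm, ← ofReal_integral_norm_eq_lintegral_enorm (hgI i),
      ENNReal.toReal_ofReal (integral_nonneg fun t => norm_nonneg _)] at h2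
    exact h2
  obtain ⟨ns, h, hns, hH, hn, hlim⟩ := exists_damping_sequence (g := fun i => (g i : LZero)) hgI hg0
  obtain ⟨C, hC, hfC⟩ := exists_bound_of_mem_LInfSet hfb
  -- The distance from `f` to `h² x` is at most `|f| + |h² f| + |h² (x - f)| ≤ C + C + 1`.
  obtain ⟨n, hnC⟩ := exists_nat_ge (1 + 2 * C)
  have h1L : (1 : LZero) ∈ LInfSet := mem_LInfSet_of_bound 1 (by
    filter_upwards [AEEqFun.coeFn_one (α := Torus) (β := ℂ) (μ := haar)] with t ht
    rw [ht]; simp)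
  have hk : ∀ᵐ t ∂haar, ∀ i, (h i * (h i * (x (ns i) : LZero)) : LZero) t =
      h i t ^ 2 * x (ns i) t := ae_all_iff.2 fun i => coeFn_mul_mul (h i) _
  refine hW.mem_of_ae_tendsto hα hcont (F := 1) (hα.subset_gaugeClosure subset_rfl h1L)
    (hα.subset_gaugeClosure subset_rfl hfb) (g := fun i => h i * (h i * (x (ns i) : LZero)))
    (fun i => HInf_mul_mem hα hcont hW hz (hH i) (HInf_mul_mem hα hcont hW hz (hH i) (hx _)))
    n (fun i => ?_) ?_
  · filter_upwards [hn i, hk, hfC, Lp.coeFn_sub (x (ns i)) f,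
      AEEqFun.coeFn_one (α := Torus) (β := ℂ) (μ := haar)] with t h1 h2 h3 h4 h5
    rw [h2, h5]
    have h6 : f t - h i t ^ 2 * x (ns i) t =
        (f t - h i t ^ 2 * f t) - h i t ^ 2 * (x (ns i) t - f t) := by ring
    have h7 : ‖h i t‖ ^ 2 ≤ 1 := by
      by_contra hcon
      push Not at hcon
      nlinarith [norm_nonneg ((g (ns i) : LTwo) t)]
    have h8 : ‖h i t ^ 2 * (x (ns i) t - f t)‖ ≤ 1 := by
      have h9 : (g (ns i) : LTwo) t = x (ns i) t - f t := h4
      rw [norm_mul, norm_pow, ← h9]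
      nlinarith [norm_nonneg ((g (ns i) : LTwo) t), sq_nonneg ‖h i t‖]
    have h10 : ‖h i t ^ 2 * f t‖ ≤ C := by
      rw [norm_mul, norm_pow]
      exact (mul_le_of_le_one_left (norm_nonneg _) h7).trans h3
    rw [h6]
    simp only [Pi.one_apply, norm_one, mul_one]
    have h11 := norm_sub_le (f t - h i t ^ 2 * f t) (h i t ^ 2 * (x (ns i) t - f t))
    have h12 := norm_sub_le (f t) (h i t ^ 2 * f t)
    linarith
  · filter_upwards [hk, hlim, hae] with t h1 h2 h3
    simp_rw [h1]
    simpa using (h2.pow 2).mul (h3.comp hns.tendsto_atTop)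

/-! ### Invariance of `H^α` and `L^α` under multiplication by `z` -/

theorem HGauge_subset_LGauge (α : LInf → ℝ) : HGauge α ⊆ LGauge α :=
  gaugeClosure_mono fun _ hf => hf.1

theorem norm_zfun : ∀ᵐ t ∂haar, ‖zfun t‖ = 1 := by
  filter_upwards [coeFn_zfun] with t ht
  rw [ht, Circle.norm_coe]

theorem zfun_mem_LInfSet : zfun ∈ LInfSet :=
  mem_LInfSet_of_bound 1 (norm_zfun.mono fun _ ht => ht.le)

theorem fourierCoeff_zfun_mul (f : LZero) (n : ℤ) :
    fourierCoeff (zfun * f : LZero) n = fourierCoeff f (n - 1) := by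
  apply integral_congr_ae
  filter_upwards [AEEqFun.coeFn_mul zfun f, coeFn_zfun] with t h1 h2
  rw [h1, Pi.mul_apply, h2, ← fourier_one, smul_eq_mul, smul_eq_mul, ← mul_assoc, ← fourier_add]
  congr 3
  ring

theorem zfun_mul_mem_HInfSet {f : LZero} (hf : f ∈ HInfSet) : zfun * f ∈ HInfSet :=
  ⟨mul_mem_LInfSet zfun_mem_LInfSet hf.1, fun n hn => by
    rw [fourierCoeff_zfun_mul]
    exact hf.2 _ (by omega)⟩

theorem mulSet_zfun_subset_of_eq {W S : Set LZero} {φ : LZero} (hW : W = mulSet φ S)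
    (hS : ∀ f ∈ S, zfun * f ∈ S) : mulSet zfun W ⊆ W := by
  subst hW
  rintro _ ⟨_, ⟨f, hf, rfl⟩, rfl⟩
  exact ⟨zfun * f, hS f hf, mul_left_comm φ zfun f⟩

theorem zfun_mul_mem_HGauge {α : LInf → ℝ} {f : LZero} (hf : f ∈ HGauge α) :
    zfun * f ∈ HGauge α :=
  gaugeClosure_mul (norm_zfun.mono fun _ ht => ht.le) (fun _ => zfun_mul_mem_HInfSet) hf

theorem zfun_mul_mem_LGauge {α : LInf → ℝ} {f : LZero} (hf : f ∈ LGauge α) :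
    zfun * f ∈ LGauge α :=
  gaugeClosure_mul (norm_zfun.mono fun _ ht => ht.le)
    (fun _ => mul_mem_LInfSet zfun_mem_LInfSet) hf

theorem coe_shift_one (f : LTwo) : (shift 1 f : LZero) = zfun * (f : LZero) := by
  apply AEEqFun.ext
  filter_upwards [coeFn_shift 1 f, AEEqFun.coeFn_mul zfun (f : LZero), coeFn_zfun] with t h1 h2 h3
  rw [h1, h2, Pi.mul_apply, h3, fourier_one]

theorem shift_one_mem_boundedPart {W : Submodule ℂ LZero} (hz : mulSet zfun W ⊆ W) {f : LTwo}
    (hf : f ∈ boundedPart W) : shift 1 f ∈ boundedPart W := by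
  refine ⟨?_, ?_⟩ <;> rw [coe_shift_one]
  · exact hz ⟨_, hf.1, rfl⟩
  · exact mul_mem_LInfSet zfun_mem_LInfSet hf.2

theorem memLp_two_of_mem_LInfSet {f : LZero} (hf : f ∈ LInfSet) : f ∈ Lp ℂ 2 haar :=
  Lp.mem_Lp_iff_memLp.2 ((Lp.mem_Lp_iff_memLp.1 hf).mono_exponent le_top)

theorem coeFn_chi (E : Set Torus) (hE : MeasurableSet E) :
    (chi E hE : Torus → ℂ) =ᵐ[haar] E.indicator fun _ => (1 : ℂ) :=
  indicatorConstLp_coeFn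

theorem norm_chi_le (E : Set Torus) (hE : MeasurableSet E) :
    ∀ᵐ t ∂haar, ‖chi E hE t‖ ≤ 1 := by
  filter_upwards [coeFn_chi E hE] with t ht
  rw [ht]
  by_cases h : t ∈ E <;> simp [h]

/-! ### The doubly and simply invariant cases -/

variable {α : LInf → ℝ} {W : Submodule ℂ LZero}

/-- If the bounded part of `W` has a doubly invariant closure in `L²`, then `W = χ_E L^α`. -/
theorem exists_eq_mulSet_chi (hα : IsDominatingGaugeNorm α) (hcont : IsContinuousGauge α)
    (hW : IsClosedSubspace α W) (hz : mulSet zfun W ⊆ W)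
    (hinv : ∀ f ∈ (boundedPart W).topologicalClosure,
      shift (-1) f ∈ (boundedPart W).topologicalClosure) :
    ∃ (E : Set Torus) (hE : MeasurableSet E), (W : Set LZero) = mulSet (chi E hE) (LGauge α) := by
  set K := (boundedPart W).topologicalClosure with hK
  have : CompleteSpace K := (boundedPart W).isClosed_topologicalClosure.completeSpace_coe
  have hfwd : ∀ f ∈ K, shift 1 f ∈ K := fun f hf =>
    shift_mem_topologicalClosure (fun _ => shift_one_mem_boundedPart hz) hf
  have hall : ∀ (n : ℤ), ∀ f ∈ K, shift n f ∈ K := fun n f hf => by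
    induction n using Int.induction_on with
    | zero => rwa [shift_zero]
    | succ i ih =>
      rw [add_comm, ← shift_shift]
      exact hfwd _ ih
    | pred i ih =>
      rw [sub_eq_neg_add, ← shift_shift]
      exact hinv _ ih
  let one : LTwo := indicatorConstLp 2 MeasurableSet.univ (measure_ne_top haar Set.univ) (1 : ℂ)
  have hone : ∀ᵐ t ∂haar, one t = 1 := by
    filter_upwards [indicatorConstLp_coeFn (p := 2) (hs := MeasurableSet.univ)
      (hμs := measure_ne_top haar Set.univ) (c := (1 : ℂ))] with t ht
    rw [ht]; simp
  obtain ⟨g, hg, e, he, hsum⟩ := K.exists_add_mem_mem_orthogonal one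
  have hge : ∀ᵐ t ∂haar, g t + e t = 1 := by
    filter_upwards [hone, Lp.coeFn_add g e] with t h1 h2
    rw [← h1, hsum, h2, Pi.add_apply]
  -- All shifts of `f`, in both directions, lie in `K` and are orthogonal to `e`; these inner
  -- products are the Fourier coefficients of `conj e · f`.
  have hef : ∀ f ∈ K, ∀ᵐ t ∂haar, conj (e t) * f t = 0 := fun f hf => by
    refine ae_eq_zero_of_integral_fourier (integrable_conj_mul e f) fun n => ?_
    rw [← inner_shift]
    exact Submodule.inner_left_of_mem_orthogonal (hall n f hf) he
  have hgm : Measurable g := (Lp.stronglyMeasurable g).measurable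
  let E : Set Torus := g ⁻¹' {1}
  have hE : MeasurableSet E := hgm (measurableSet_singleton 1)
  -- Taking `f = g` gives `conj e · g = 0`, and with `g + e = 1` this leaves only the values `0` and
  -- `1` for `g`.
  have hgχ : ∀ᵐ t ∂haar, g t = chi E hE t ∧ e t = 1 - chi E hE t := by
    filter_upwards [hef g hg, hge, coeFn_chi E hE] with t h1 h2 h3
    rw [h3]
    rcases mul_eq_zero.1 h1 with h4 | h4
    · rw [map_eq_zero] at h4
      have h5 : t ∈ E := by
        rw [h4, add_zero] at h2
        exact h2
      rw [Set.indicator_of_mem h5, h4]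
      exact ⟨h5, by simp⟩
    · have h5 : t ∉ E := fun h => by
        have h6 : g t = 1 := h
        rw [h4] at h6
        exact zero_ne_one h6
      rw [Set.indicator_of_notMem h5]
      rw [h4, zero_add] at h2
      simp [h4, h2]
  have hmulK : ∀ f ∈ K, ∀ᵐ t ∂haar, chi E hE t * f t = f t := fun f hf => by
    filter_upwards [hef f hf, hgχ, coeFn_chi E hE] with t h1 h2 h3
    rw [h2.2, h3] at h1
    rw [h3]
    by_cases ht : t ∈ E
    · simp [ht]
    · simp only [ht, not_false_eq_true, Set.indicator_of_notMem, sub_zero, map_one, one_mul] at h1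
      simp [ht, h1]
  refine ⟨E, hE, Set.Subset.antisymm (fun f hf => ?_) ?_⟩
  · refine ⟨f, hW.subset_LGauge hf, ?_⟩
    obtain ⟨k, hk, -, hlim⟩ := exists_bounded_approx hα hcont hW hz hf
    have hk2 : ∀ᵐ t ∂haar, ∀ i, chi E hE t * k i t = k i t := ae_all_iff.2 fun i =>
      hmulK ⟨k i, memLp_two_of_mem_LInfSet (hk i).2⟩
        ((boundedPart W).le_topologicalClosure (hk i))
    apply AEEqFun.ext
    filter_upwards [hk2, hlim, AEEqFun.coeFn_mul (chi E hE : LZero) f] with t h1 h2 h3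
    rw [h3, Pi.mul_apply]
    have h4 := h2.const_mul (chi E hE t)
    simp_rw [h1] at h4
    exact tendsto_nhds_unique h4 h2
  · rintro _ ⟨f, hf, rfl⟩
    refine hW.closed _ (hα.mul_mem_LGauge (chi E hE).2 hf)
      (gaugeClosure_mul (norm_chi_le E hE) (fun b hb => ?_) hf)
    let B : LTwo := ⟨b, memLp_two_of_mem_LInfSet hb⟩
    -- Each `χ_E z^n` is a shift of `g`, hence in `K`; density of trigonometric polynomials then
    -- gives `χ_E L² ⊆ K`.
    have hspan : Submodule.span ℂ (Set.range (fourierLp (T := 2 * Real.pi) 2)) ≤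
        K.comap (mulL (chi E hE)).toLinearMap := by
      refine Submodule.span_le.2 ?_
      rintro _ ⟨n, rfl⟩
      change mulL (chi E hE) (fourierLp 2 n) ∈ K
      have : mulL (chi E hE) (fourierLp 2 n) = shift n g := by
        apply Lp.ext
        filter_upwards [coeFn_mulL (chi E hE) (fourierLp 2 n), coeFn_shift n g, hgχ,
          coeFn_fourierLp (T := 2 * Real.pi) 2 n] with t h1 h2 h3 h4
        rw [h1, h2, h3.1, h4, mul_comm]
      rw [this]
      exact hall n g hg
    have hKcl : IsClosed (K : Set LTwo) := (boundedPart W).isClosed_topologicalClosure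
    have htop := Submodule.topologicalClosure_minimal _ hspan
      (hKcl.preimage (mulL (chi E hE)).continuous)
    rw [span_fourierLp_closure_eq_top (by simp)] at htop
    have hB : mulL (chi E hE) B ∈ K := htop (Submodule.mem_top (x := B))
    have hBe : (mulL (chi E hE) B : LZero) = (chi E hE : LZero) * b := by
      apply AEEqFun.ext
      filter_upwards [coeFn_mulL (chi E hE) B, AEEqFun.coeFn_mul (chi E hE : LZero) b] with t h1 h2
      rw [h1, h2]
      rfl
    have hbd := mul_mem_LInfSet (chi E hE).2 hb
    rw [← hBe] at hbd ⊢
    exact mem_of_mem_closure_boundedPart hα hcont hW hz hB hbd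

/-- A closed subspace of `L²` that is invariant under the shift, but not under its inverse,
contains a unimodular function orthogonal to the image of the shift. -/
theorem exists_wandering {K : Submodule ℂ LTwo} (hKcl : IsClosed (K : Set LTwo))
    (hfwd : ∀ f ∈ K, shift 1 f ∈ K) {f₀ : LTwo} (hf₀ : f₀ ∈ K) (hf₀' : shift (-1) f₀ ∉ K) :
    ∃ φ ∈ K, (∀ᵐ t ∂haar, ‖φ t‖ = 1) ∧ ∀ n : ℤ, 0 < n → ∀ f ∈ K, ⟪φ, shift n f⟫_ℂ = 0 := by
  have hnat : ∀ (n : ℕ), ∀ f ∈ K, shift n f ∈ K := fun n f hf => by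
    induction n with
    | zero => rwa [Nat.cast_zero, shift_zero]
    | succ i ih =>
      rw [Nat.cast_succ, add_comm, ← shift_shift]
      exact hfwd _ ih
  -- `K₁` is `zK`, written as the preimage of `K` under the inverse shift so that it is visibly
  -- closed. It misses `f₀`, so `f₀` has a nonzero component orthogonal to it.
  obtain ⟨K₁, hK₁cl, hmem⟩ : ∃ K₁ : Submodule ℂ LTwo, IsClosed (K₁ : Set LTwo) ∧
      ∀ f, f ∈ K₁ ↔ shift (-1) f ∈ K :=
    ⟨K.comap (shift (-1)).toLinearMap, hKcl.preimage (shift (-1)).continuous,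
      fun _ => Submodule.mem_comap⟩
  have : CompleteSpace K₁ := hK₁cl.completeSpace_coe
  have hK₁K : K₁ ≤ K := fun f hf => by
    have h1 : shift 1 (shift (-1) f) ∈ K := hfwd _ ((hmem f).1 hf)
    rwa [shift_shift, add_neg_cancel, shift_zero] at h1
  have hpos : ∀ n : ℤ, 0 < n → ∀ f ∈ K, shift n f ∈ K₁ := fun n hn f hf => by
    obtain ⟨m, rfl⟩ : ∃ m : ℕ, n = 1 + m := ⟨(n - 1).toNat, by omega⟩
    rw [hmem, shift_shift, neg_add_cancel_left]
    exact hnat _ f hf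
  obtain ⟨y, hy, φ₀, hφ₀, hsum⟩ := K₁.exists_add_mem_mem_orthogonal f₀
  have hφ₀K : φ₀ ∈ K := by
    rw [← add_sub_cancel_left y φ₀, ← hsum]
    exact sub_mem hf₀ (hK₁K hy)
  have hφ₀0 : φ₀ ≠ 0 := fun h => by
    rw [h, add_zero] at hsum
    rw [← hsum] at hy
    exact hf₀' ((hmem f₀).1 hy)
  obtain ⟨φ, hφdef⟩ : ∃ φ : LTwo, φ = ((‖φ₀‖⁻¹ : ℝ) : ℂ) • φ₀ := ⟨_, rfl⟩
  have hφK : φ ∈ K := hφdef ▸ K.smul_mem _ hφ₀K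
  have hφn : ‖φ‖ = 1 := by
    rw [hφdef, norm_smul, Complex.norm_real, norm_inv, norm_norm,
      inv_mul_cancel₀ (norm_ne_zero_iff.2 hφ₀0)]
  have hφp : φ ∈ K₁ᗮ := hφdef ▸ K₁ᗮ.smul_mem _ hφ₀
  have hφorth : ∀ n : ℤ, 0 < n → ∀ f ∈ K, ⟪φ, shift n f⟫_ℂ = 0 := fun n hn f hf =>
    Submodule.inner_left_of_mem_orthogonal (hpos n hn f hf) hφp
  refine ⟨φ, hφK, ?_, hφorth⟩
  filter_upwards [norm_sq_eq_of_inner_shift_eq_zero fun n hn => hφorth n hn φ hφK] with t ht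
  rw [hφn] at ht
  exact (sq_eq_sq₀ (norm_nonneg _) zero_le_one).1 ht

/-- If the bounded part of `W` has a simply invariant closure in `L²`, then `W = φ H^α`. -/
theorem exists_eq_mulSet_unimodular (hα : IsDominatingGaugeNorm α) (hcont : IsContinuousGauge α)
    (hW : IsClosedSubspace α W) (hz : mulSet zfun W ⊆ W)
    {f₀ : LTwo} (hf₀ : f₀ ∈ (boundedPart W).topologicalClosure)
    (hf₀' : shift (-1) f₀ ∉ (boundedPart W).topologicalClosure) :
    ∃ φ : LZero, IsUnimodular φ ∧ (W : Set LZero) = mulSet φ (HGauge α) := by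
  obtain ⟨φ, hφK, hφuni, hφorth⟩ := exists_wandering
    (boundedPart W).isClosed_topologicalClosure
    (fun f hf => shift_mem_topologicalClosure (fun _ => shift_one_mem_boundedPart hz) hf)
    hf₀ hf₀'
  have hφL : (φ : LZero) ∈ LInfSet := mem_LInfSet_of_bound 1 (hφuni.mono fun t ht => ht.le)
  have hφW : (φ : LZero) ∈ W := mem_of_mem_closure_boundedPart hα hcont hW hz hφK hφL
  let ψ : LZero := star (φ : LZero)
  have hψ : ∀ᵐ t ∂haar, ψ t = conj (φ t) := AEEqFun.coeFn_star (φ : LZero)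
  have hψ1 : ∀ᵐ t ∂haar, ‖ψ t‖ ≤ 1 := by
    filter_upwards [hψ, hφuni] with t h1 h2
    rw [h1, RCLike.norm_conj, h2]
  have hψL : ψ ∈ LInfSet := mem_LInfSet_of_bound 1 hψ1
  refine ⟨φ, hφuni, Set.Subset.antisymm (fun f hf => ?_) ?_⟩
  · refine ⟨ψ * f, gaugeClosure_mul hψ1 (fun k hk => ?_)
      (mem_gaugeClosure_bounded hα hcont hW hz hf), ?_⟩
    · refine ⟨mul_mem_LInfSet hψL hk.2, fun n hn => ?_⟩
      obtain ⟨k₂, hk₂⟩ : ∃ k₂ : LTwo, (k₂ : LZero) = k := ⟨⟨k, memLp_two_of_mem_LInfSet hk.2⟩, rfl⟩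
      have hk₂K : k₂ ∈ (boundedPart W).topologicalClosure := by
        apply (boundedPart W).le_topologicalClosure
        change (k₂ : LZero) ∈ W ∧ (k₂ : LZero) ∈ LInfSet
        rwa [hk₂]
      -- The coefficient of `conj φ · k` at `n < 0` is the inner product of `φ` with `z^(-n) k`,
      -- which lies in `zK`.
      rw [← hφorth (-n) (neg_pos.2 hn) k₂ hk₂K, inner_shift, ← hk₂]
      apply integral_congr_ae
      filter_upwards [AEEqFun.coeFn_mul ψ (k₂ : LZero), hψ] with t h1 h2
      rw [h1, Pi.mul_apply, h2, smul_eq_mul]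
    · apply AEEqFun.ext
      filter_upwards [AEEqFun.coeFn_mul (φ : LZero) (ψ * f), AEEqFun.coeFn_mul ψ f, hψ, hφuni]
        with t h1 h2 h3 h4
      rw [h1, Pi.mul_apply, h2, Pi.mul_apply, h3, ← mul_assoc, Complex.mul_conj,
        Complex.normSq_eq_norm_sq, h4]
      simp
  · rintro _ ⟨f, hf, rfl⟩
    refine hW.closed _ (hα.mul_mem_LGauge hφL (HGauge_subset_LGauge α hf))
      (gaugeClosure_mul (hφuni.mono fun t ht => ht.le) (fun b hb => ?_) hf)
    rw [mul_comm (φ : LZero) b]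
    exact HInf_mul_mem hα hcont hW hz hb hφW

/-! ### Invariant subspaces of `H^α` -/

/-- Fourier coefficients are `α`-continuous, being bounded by the `L¹` norm and hence by `α`, so
their vanishing passes from `H^∞` to its closure. -/
theorem fourierCoeff_eq_zero_of_mem_HGauge (hα : IsDominatingGaugeNorm α) {f : LZero}
    (hf : f ∈ HGauge α) {n : ℤ} (hn : n < 0) : fourierCoeff f n = 0 := by
  have hfI := hα.integrable_of_gaugeExt_lt_top hf.1
  have key : ∀ ε : ℝ≥0∞, 0 < ε → ‖fourierCoeff f n‖ₑ ≤ ε := fun ε hε => by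
    obtain ⟨g, hg, hfg⟩ := hf.2 ε hε
    have hgI : Integrable g haar := (Lp.mem_Lp_iff_memLp.1 hg.1).integrable le_top
    have h1 : fourierCoeff f n = ∫ t, fourier (-n) t * (f - g) t ∂haar := by
      have h2 : ∫ t, fourier (-n) t * (f - g) t ∂haar =
          ∫ t, (fourier (-n) t * f t - fourier (-n) t * g t) ∂haar := by
        apply integral_congr_ae
        filter_upwards [AEEqFun.coeFn_sub f g] with t ht
        rw [ht, Pi.sub_apply, mul_sub]
      rw [h2, integral_sub (integrable_fourier_mul hfI _) (integrable_fourier_mul hgI _)]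
      have h3 : ∫ t, fourier (-n) t * g t ∂haar = 0 := hg.2 n hn
      rw [h3, sub_zero]
      rfl
    rw [h1]
    refine (enorm_integral_le_lintegral_enorm _).trans (le_trans (le_of_eq ?_)
      ((hα.lintegral_le_gaugeExt (f - g)).trans hfg.le))
    refine lintegral_congr fun t => ?_
    rw [enorm_mul, fourier_apply, ← ofReal_norm, Circle.norm_coe]
    simp
  have h0 : ‖fourierCoeff f n‖ₑ = 0 := by
    by_contra hcon
    have h1 : 0 < ‖fourierCoeff f n‖ₑ := pos_iff_ne_zero.2 hcon
    obtain ⟨r, hr0, hr⟩ := exists_between h1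
    exact absurd (key r hr0) (not_le.2 hr)
  exact enorm_eq_zero.1 h0

theorem one_mem_HInfSet : (1 : LZero) ∈ HInfSet := by
  have h1 := AEEqFun.coeFn_one (α := Torus) (β := ℂ) (μ := haar)
  refine ⟨mem_LInfSet_of_bound 1 (by filter_upwards [h1] with t ht; rw [ht]; simp), fun n hn => ?_⟩
  have h2 : (((1 : LZero) : Torus → ℂ)) =ᵐ[haar] fourier 0 := by
    filter_upwards [h1] with t ht
    rw [ht, fourier_zero, Pi.one_apply]
  rw [fourierCoeff_congr_ae h2, fourierCoeff_fourier, Pi.single_eq_of_ne (by omega)]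

theorem eq_bot_of_eq_mulSet_chi (hα : IsDominatingGaugeNorm α) {E : Set Torus}
    {hE : MeasurableSet E} (hW : (W : Set LZero) = mulSet (chi E hE) (LGauge α))
    (hH : (W : Set LZero) ⊆ HGauge α) : W = ⊥ := by
  have hint : Integrable (chi E hE) haar := (Lp.memLp (chi E hE)).integrable le_top
  have hzero : chi E hE =ᵐ[haar] 0 := by
    refine ae_eq_zero_of_integral_fourier hint fun n => ?_
    -- The exponent `n - 1` moves an arbitrary Fourier integral of `χ_E` to index `-1`, where
    -- elements of `H^α` have coefficient zero.
    have h1 : (chi E hE : LZero) * (expo (n - 1) : LZero) ∈ HGauge α := hH (by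
      rw [hW]
      exact ⟨_, hα.subset_gaugeClosure subset_rfl (expo (n - 1)).2, rfl⟩)
    rw [← fourierCoeff_eq_zero_of_mem_HGauge hα h1 (n := -1) (by norm_num)]
    apply integral_congr_ae
    filter_upwards [AEEqFun.coeFn_mul (chi E hE : LZero) (expo (n - 1) : LZero),
      coeFn_expo (n - 1)] with t h2 h3
    rw [h2, Pi.mul_apply, h3, smul_eq_mul, mul_left_comm, ← fourier_add, mul_comm]
    congr 3
    ring
  refine (Submodule.eq_bot_iff W).2 fun f hf => ?_
  have hf' : f ∈ mulSet (chi E hE) (LGauge α) := hW ▸ hf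
  obtain ⟨k, -, rfl⟩ := hf'
  apply AEEqFun.ext
  filter_upwards [AEEqFun.coeFn_mul (chi E hE : LZero) k, hzero,
    AEEqFun.coeFn_zero (α := Torus) (β := ℂ) (μ := haar)] with t h1 h2 h3
  rw [h1, Pi.mul_apply, h2, h3]
  simp

/-- The invariant subspace dichotomy. -/
theorem exists_eq_mulSet (hα : IsDominatingGaugeNorm α) (hcont : IsContinuousGauge α)
    (hW : IsClosedSubspace α W) (hz : mulSet zfun W ⊆ W) :
    (∃ φ : LZero, IsUnimodular φ ∧ (W : Set LZero) = mulSet φ (HGauge α)) ∨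
      ∃ (E : Set Torus) (hE : MeasurableSet E),
        (W : Set LZero) = mulSet (chi E hE) (LGauge α) := by
  by_cases h : ∀ f ∈ (boundedPart W).topologicalClosure,
      shift (-1) f ∈ (boundedPart W).topologicalClosure
  · exact Or.inr (exists_eq_mulSet_chi hα hcont hW hz h)
  · push Not at h
    obtain ⟨f, hf, hf'⟩ := h
    exact Or.inl (exists_eq_mulSet_unimodular hα hcont hW hz hf hf')

end GaugeHardy

end

theorem theorem3p6 (α : GaugeHardy.LInf → ℝ)
    (hα : GaugeHardy.IsDominatingGaugeNorm α) (hcont : GaugeHardy.IsContinuousGauge α)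
    (W : Submodule ℂ GaugeHardy.LZero) (hW : GaugeHardy.IsClosedSubspace α W) :
    (GaugeHardy.mulSet GaugeHardy.zfun W ⊆ W ↔
      (∃ φ : GaugeHardy.LZero, GaugeHardy.IsUnimodular φ ∧
        (W : Set GaugeHardy.LZero) = GaugeHardy.mulSet φ (GaugeHardy.HGauge α)) ∨
      (∃ (E : Set GaugeHardy.Torus) (hE : MeasurableSet E),
        (W : Set GaugeHardy.LZero) =
          GaugeHardy.mulSet (GaugeHardy.chi E hE : GaugeHardy.LZero) (GaugeHardy.LGauge α))) ∧
    (GaugeHardy.mulSet GaugeHardy.zfun W ⊆ W → W ≠ ⊥ →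
      (W : Set GaugeHardy.LZero) ⊆ GaugeHardy.HGauge α →
      ∃ φ : GaugeHardy.LZero, GaugeHardy.IsInner φ ∧
        (W : Set GaugeHardy.LZero) = GaugeHardy.mulSet φ (GaugeHardy.HGauge α)) := by
  refine ⟨⟨GaugeHardy.exists_eq_mulSet hα hcont hW, ?_⟩, fun hz hne hH => ?_⟩
  · rintro (⟨φ, -, h⟩ | ⟨E, hE, h⟩)
    · exact GaugeHardy.mulSet_zfun_subset_of_eq h fun f => GaugeHardy.zfun_mul_mem_HGauge
    · exact GaugeHardy.mulSet_zfun_subset_of_eq h fun f => GaugeHardy.zfun_mul_mem_LGauge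
  · rcases GaugeHardy.exists_eq_mulSet hα hcont hW hz with ⟨φ, hφ, h⟩ | ⟨E, hE, h⟩
    · have h1 : (1 : GaugeHardy.LZero) ∈ GaugeHardy.HGauge α :=
        hα.subset_gaugeClosure (fun f hf => hf.1) GaugeHardy.one_mem_HInfSet
      -- Since `1` is in `H^α`, `φ = φ · 1` lies in `W`, hence in `H^α`; being bounded with no
      -- negative coefficients, it is in `H^∞`.
      have h2 : φ ∈ GaugeHardy.HGauge α := hH (by
        rw [h]
        exact ⟨1, h1, mul_one φ⟩)
      exact ⟨φ, ⟨⟨GaugeHardy.mem_LInfSet_of_bound 1 (hφ.mono fun t ht => ht.le), fun n hn =>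
        GaugeHardy.fourierCoeff_eq_zero_of_mem_HGauge hα h2 hn⟩, hφ⟩, h⟩
    · exact absurd (GaugeHardy.eq_bot_of_eq_mulSet_chi hα h hH) hne
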